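/- Let $n\ge 1$, $p\in(1,\infty)$, $\beta>0$, $R>0$, and let $B_R\subset\mathbb{R}^n$ be a closed ball of radius $R$ with arbitrary centre. For a compact set $D$ and a bounded open set $\Omega$ with Lipschitz boundary, $D\subset\overline\Omega$, put $$I_{\beta,p}(D,\Omega)=\inf\Big\{\int_\Omega|D\varphi|^p\,dx+\beta\int_{\partial\Omega}|\varphi|^p\,d\mathcal H^{n-1}\;:\;\varphi\in W^{1,p}(\Omega),\ \varphi\ge1 \text{ a.e. in } D\Big\},$$ where the values of $\varphi$ on $\partial\Omega$ are those of its trace. For $\delta>0$ put $I_{\beta,p,\delta}(D)=I_{\beta,p}(D,D+\delta B)$, where $B$ is the open unit ball centred at the origin and $D+\delta B$ is the Minkowski sum; thus for $D=B_R$ the set $\Omega=D+\delta B$ is the concentric open ball $B_{R+\delta}$. Then: 1. If $\beta\ge\Big[\dfrac{n-1}{R(p-1)}\Big]^{p-1}$, then $\delta\mapsto I_{\beta,p,\delta}(B_R)$ is strictly decreasing on $(0,\infty)$. 2. If $\beta<\Big[\dfrac{n-1}{R(p-1)}\Big]^{p-1}$, then, with $\delta_0=\dfrac{n-1}{p-1}\,\dfrac{1}{\beta^{1/(p-1)}}-R>0$,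 the map $\delta\mapsto I_{\beta,p,\delta}(B_R)$ is strictly increasing on $(0,\delta_0)$ and strictly decreasing on $(\delta_0,\infty)$. -/

import Mathlib

open MeasureTheory Set Filter Topology
open scoped ContDiff Gradient Pointwise

/-- `φ` belongs to the Sobolev space `W^{1,p}(Ω)` and `G` is its weak gradient on `Ω`: both are
`L^p` on `Ω`, and `∫_Ω φ ∂_v ψ = - ∫_Ω (G · v) ψ` for every test function `ψ ∈ C_c^∞(Ω)` and every
direction `v`. -/
structure IsSobolevWithGradient {n : ℕ} (p : ℝ) (Ω : Set (EuclideanSpace ℝ (Fin n)))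
    (φ : EuclideanSpace ℝ (Fin n) → ℝ)
    (G : EuclideanSpace ℝ (Fin n) → EuclideanSpace ℝ (Fin n)) : Prop where
  memLp : MemLp φ (ENNReal.ofReal p) (volume.restrict Ω)
  memLp_gradient : MemLp G (ENNReal.ofReal p) (volume.restrict Ω)
  integral_by_parts : ∀ ψ : EuclideanSpace ℝ (Fin n) → ℝ, ContDiff ℝ ∞ ψ → HasCompactSupport ψ →
    tsupport ψ ⊆ Ω → ∀ v : EuclideanSpace ℝ (Fin n),
      ∫ x in Ω, φ x * fderiv ℝ ψ x v = - ∫ x in Ω, inner ℝ (G x) v * ψ x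

/-- The surface measure `H^{n-1}` on the boundary `∂Ω` of a set `Ω ⊆ ℝⁿ` (the normalisation of the
Hausdorff measure is the one for which `H^{n-1}` is Lebesgue measure on `ℝ^{n-1}`). -/
noncomputable def boundaryMeasure {n : ℕ} (Ω : Set (EuclideanSpace ℝ (Fin n))) :
    Measure (EuclideanSpace ℝ (Fin n)) :=
  (Measure.euclideanHausdorffMeasure (n - 1)).restrict (frontier Ω)

/-- `g ∈ L^p(∂Ω)` is the trace on `∂Ω` of the function `φ ∈ W^{1,p}(Ω)` with weak gradient `G`.
For a bounded Lipschitz domain the trace operator `W^{1,p}(Ω) → L^p(∂Ω)` is the continuous extension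
of the restriction map `f ↦ f|_{∂Ω}` from (the dense class of) functions smooth up to the boundary:
there are smooth `f k` with `f k → φ` in `W^{1,p}(Ω)` and `f k|_{∂Ω} → g` in `L^p(∂Ω)`. -/
def IsTrace {n : ℕ} (p : ℝ) (Ω : Set (EuclideanSpace ℝ (Fin n)))
    (φ : EuclideanSpace ℝ (Fin n) → ℝ)
    (G : EuclideanSpace ℝ (Fin n) → EuclideanSpace ℝ (Fin n))
    (g : EuclideanSpace ℝ (Fin n) → ℝ) : Prop :=
  MemLp g (ENNReal.ofReal p) (boundaryMeasure Ω) ∧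
  ∃ f : ℕ → EuclideanSpace ℝ (Fin n) → ℝ, (∀ k, ContDiff ℝ ∞ (f k)) ∧
    Tendsto (fun k => eLpNorm (fun x => f k x - φ x) (ENNReal.ofReal p) (volume.restrict Ω))
      atTop (𝓝 0) ∧
    Tendsto (fun k => eLpNorm (fun x => ∇ (f k) x - G x) (ENNReal.ofReal p) (volume.restrict Ω))
      atTop (𝓝 0) ∧
    Tendsto (fun k => eLpNorm (fun x => f k x - g x) (ENNReal.ofReal p) (boundaryMeasure Ω))
      atTop (𝓝 0)

/-- `I_{β,p}(D, Ω)`, the infimum of `∫_Ω |Dφ|^p dx + β ∫_{∂Ω} |φ|^p dH^{n-1}` over all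
`φ ∈ W^{1,p}(Ω)` with `φ ≥ 1` (almost everywhere) in `D`; the boundary values are those of the
trace of `φ`. -/
noncomputable def insulationEnergy {n : ℕ} (β p : ℝ) (D Ω : Set (EuclideanSpace ℝ (Fin n))) : ℝ :=
  sInf {E : ℝ | ∃ (φ : EuclideanSpace ℝ (Fin n) → ℝ)
      (G : EuclideanSpace ℝ (Fin n) → EuclideanSpace ℝ (Fin n))
      (g : EuclideanSpace ℝ (Fin n) → ℝ),
    IsSobolevWithGradient p Ω φ G ∧ IsTrace p Ω φ G g ∧
    (∀ᵐ x ∂(volume.restrict Ω), x ∈ D → 1 ≤ φ x) ∧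
    E = (∫ x in Ω, ‖G x‖ ^ p) + β * ∫ x, |g x| ^ p ∂(boundaryMeasure Ω)}

/-- `I_{β,p,δ}(D) = I_{β,p}(D, D + δB)`, where `B` is the open unit ball centred at the origin and
`D + δB` is the Minkowski sum. -/
noncomputable def insulationEnergyThickness {n : ℕ} (β p δ : ℝ)
    (D : Set (EuclideanSpace ℝ (Fin n))) : ℝ :=
  insulationEnergy β p D (D + δ • Metric.ball (0 : EuclideanSpace ℝ (Fin n)) 1)

/-! The energy of a ball in a concentric ball is explicit. Put γ = (n-1)/(p-1), b = β^(-1/(p-1)),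
let S be the area of the unit sphere and Λ(ρ) = ∫_R^ρ s^(-γ) ds + b ρ^(-γ) (`thermalResistance`).
Then the energy in the ball of radius ρ equals S Λ(ρ)^(-(p-1)) (`insulationEnergy_ball`). Since
Λ'(ρ) = ρ^(-γ) (1 - γb/ρ), Λ decreases up to the critical radius γb and increases after it, and the
energy does the opposite. The threshold on β says whether γb ≤ R, and δ₀ = γb - R.

The formula comes from the radial p-harmonic profile h that is 1 at radius R and has slope -c
r^(-γ). The Robin condition h(ρ) = b |h'(ρ)| forces c = 1/Λ(ρ), and the energy of h is then S
c^(p-1). For the upper bound (`insulationEnergy_ball_le`), h is approximated by smooth radial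
competitors, which are their own traces.

The lower bound (`admissible_energy_ge`) is a calibration. The field |∇h|^(p-2) ∇h is a multiple of
y/|y|^n, which is divergence free away from the centre. Cut off inside the inner ball and paired
with the weak gradient of an admissible φ, it yields an inequality between the flux of φ and the
integral of its trace (`flux_integral_le`). Young's inequality, with equality at the optimal
profile, is applied to the gradient and to the trace; the two terms linear in the trace cancel by
the Robin condition.

Both bounds use polar coordinates, so the Hausdorff measure on the sphere has to be identified with
the surface measure of polar coordinates (`euclideanHausdorffMeasure_sphere`). The latter is d times
the volume of the cone over a set. On a small cap, both measures are compared with the area of the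
gnomonic projection to the tangent hyperplane; the distortion tends to 1 as the cap shrinks. -/

/-- If `μ A ≤ c * ν A` for all measurable sets `A` of small diameter, then `μ ≤ c • ν`. -/
theorem measure_le_smul_of_forall_small {X : Type*} [MetricSpace X]
    [SecondCountableTopology X] [MeasurableSpace X] [BorelSpace X] (μ ν : Measure X)
    (c : ENNReal) (η : ℝ) (hη : 0 < η)
    (h : ∀ x : X, ∀ A : Set X, MeasurableSet A → A ⊆ Metric.closedBall x η → μ A ≤ c * ν A)
    (A : Set X) (hA : MeasurableSet A) : μ A ≤ c * ν A := by
  rcases isEmpty_or_nonempty X with hX | hX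
  · simp [Set.eq_empty_of_isEmpty A]
  let u := TopologicalSpace.denseSeq X
  let U : ℕ → Set X := fun i => Metric.closedBall (u i) η
  have hU : ⋃ i, U i = univ := by
    rw [eq_univ_iff_forall]
    intro x
    obtain ⟨i, hi⟩ := (TopologicalSpace.denseRange_denseSeq X).exists_dist_lt x hη
    exact mem_iUnion.2 ⟨i, by simpa [U] using hi.le⟩
  have hUm : ∀ i, MeasurableSet (U i) := fun i => Metric.isClosed_closedBall.measurableSet
  have hDm : ∀ i, MeasurableSet (disjointed U i) := fun i => MeasurableSet.disjointed hUm i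
  have key : ∀ m : Measure X, m A = ∑' i, m (A ∩ disjointed U i) := by
    intro m
    rw [← measure_iUnion]
    · rw [← inter_iUnion, iUnion_disjointed, hU, inter_univ]
    · intro i j hij
      exact ((disjoint_disjointed U) hij).mono inter_subset_right inter_subset_right
    · exact fun i => hA.inter (hDm i)
  rw [key μ, key ν, ← ENNReal.tsum_mul_left]
  refine ENNReal.tsum_le_tsum fun i => h (u i) _ (hA.inter (hDm i)) ?_
  exact inter_subset_right.trans (disjointed_subset U i)

/-! ### Gnomonic projection of small spherical caps -/

section Gnomonic

variable {V : Type*} [NormedAddCommGroup V] [InnerProductSpace ℝ V]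

/-- Radial projection to the unit sphere is nonexpansive outside the open unit ball. -/
theorem lipschitzOnWith_normalize :
    LipschitzOnWith 1 (fun y : V => ‖y‖⁻¹ • y) {y | 1 ≤ ‖y‖} := by
  refine LipschitzOnWith.of_dist_le_mul fun y hy z hz => ?_
  simp only [mem_ofPred_eq] at hy hz
  rw [NNReal.coe_one, one_mul, dist_eq_norm, dist_eq_norm]
  refine le_of_sq_le_sq ?_ (norm_nonneg _)
  rw [norm_sub_sq_real, norm_sub_sq_real, norm_smul, norm_smul, inner_smul_left, inner_smul_right]
  have hy0 : ‖y‖ ≠ 0 := by positivity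
  have hz0 : ‖z‖ ≠ 0 := by positivity
  simp only [norm_inv, norm_norm, conj_trivial]
  rw [inv_mul_cancel₀ hy0, inv_mul_cancel₀ hz0]
  have hs := real_inner_le_norm y z
  have h1 : ‖y‖⁻¹ * (‖z‖⁻¹) ≤ 1 := by
    rw [← mul_inv]; exact inv_le_one_of_one_le₀ (by nlinarith)
  have h2 : ‖y‖⁻¹ * (‖z‖⁻¹) * (‖y‖ * ‖z‖) = 1 := by field_simp
  have h3 := mul_le_mul_of_nonneg_left hs (sub_nonneg.2 h1)
  nlinarith [sq_nonneg (‖y‖ - ‖z‖)]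

theorem one_sub_le_inner_of_norm_sub_le {θ x : V} {η : ℝ} (hθ : ‖θ‖ = 1) (h : ‖x - θ‖ ≤ η) :
    1 - η ≤ inner ℝ x θ := by
  have h1 : inner ℝ (θ - x) θ ≤ ‖θ - x‖ * ‖θ‖ := real_inner_le_norm _ _
  rw [inner_sub_left, real_inner_self_eq_norm_sq, hθ, norm_sub_rev] at h1
  linarith

/-- The gnomonic projection is almost nonexpansive on a small spherical cap. -/
theorem lipschitzOnWith_gnomonic {θ : V} (hθ : ‖θ‖ = 1) {η : ℝ} (hη : 0 < η) (hη1 : η < 1) :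
    LipschitzOnWith (Real.toNNReal ((1 - η)⁻¹ ^ 2)) (fun x : V => (inner ℝ x θ)⁻¹ • x)
      {x | ‖x‖ = 1 ∧ ‖x - θ‖ ≤ η} := by
  refine LipschitzOnWith.of_dist_le_mul fun x hx y hy => ?_
  obtain ⟨hx1, hx⟩ := hx
  obtain ⟨hy1, hy⟩ := hy
  rw [Real.coe_toNNReal _ (by positivity), dist_eq_norm, dist_eq_norm]
  have ha := one_sub_le_inner_of_norm_sub_le hθ hx
  have hb := one_sub_le_inner_of_norm_sub_le hθ hy
  have hη' : 0 < 1 - η := by linarith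
  have hab : |inner ℝ y θ - inner ℝ x θ| ≤ η * ‖x - y‖ := by
    -- As x and y are unit vectors, y - x is orthogonal to x + y, so θ may be replaced by θ - (x +
    -- y)/2, which has norm at most η. This gives the small factor η instead of 1.
    have h1 : inner ℝ y θ - inner ℝ x θ = inner ℝ (y - x) ((1 / 2 : ℝ) • ((θ - x) + (θ - y))) := by
      have hxx : inner ℝ x x = (1 : ℝ) := by rw [real_inner_self_eq_norm_sq, hx1]; norm_num
      have hyy : inner ℝ y y = (1 : ℝ) := by rw [real_inner_self_eq_norm_sq, hy1]; norm_num
      simp only [inner_smul_right, inner_add_right, inner_sub_right, inner_sub_left,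
        real_inner_comm x y, hxx, hyy]
      ring
    rw [h1]
    refine (abs_real_inner_le_norm _ _).trans ?_
    rw [norm_sub_rev y x, mul_comm]
    gcongr
    rw [norm_smul]
    have := norm_add_le (θ - x) (θ - y)
    rw [norm_sub_rev θ x, norm_sub_rev θ y] at this
    rw [Real.norm_of_nonneg (by norm_num)]
    linarith
  set a := inner ℝ x θ
  set b := inner ℝ y θ
  have ha0 : 0 < a := by linarith
  have hb0 : 0 < b := by linarith
  have hdec : a⁻¹ • x - b⁻¹ • y = a⁻¹ • (x - y) + ((b - a) * (a⁻¹ * b⁻¹)) • y := by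
    have : (b - a) * (a⁻¹ * b⁻¹) = a⁻¹ - b⁻¹ := by field_simp
    rw [this, smul_sub, sub_smul]; abel
  rw [hdec]
  have hia : a⁻¹ ≤ (1 - η)⁻¹ := by gcongr
  have hib : b⁻¹ ≤ (1 - η)⁻¹ := by gcongr
  calc ‖a⁻¹ • (x - y) + ((b - a) * (a⁻¹ * b⁻¹)) • y‖
      ≤ a⁻¹ * ‖x - y‖ + |b - a| * (a⁻¹ * b⁻¹) := by
        refine (norm_add_le _ _).trans ?_
        rw [norm_smul, norm_smul, hy1, mul_one, Real.norm_of_nonneg (by positivity), norm_mul,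
          Real.norm_eq_abs, Real.norm_of_nonneg (by positivity : 0 ≤ a⁻¹ * b⁻¹)]
    _ ≤ (1 - η)⁻¹ * ‖x - y‖ + (η * ‖x - y‖) * ((1 - η)⁻¹ * (1 - η)⁻¹) := by gcongr
    _ = (1 - η)⁻¹ ^ 2 * ‖x - y‖ := by field_simp; ring

/-- Points of a cone at height `x` over the hyperplane orthogonal to the axis `θ`. -/
theorem mem_mk'_orthogonal_iff {θ : V} (hθ : ‖θ‖ = 1) (x : ℝ) (y : V) :
    y ∈ AffineSubspace.mk' (x • θ +ᵥ (0 : V)) (ℝ ∙ θ)ᗮ ↔ inner ℝ y θ = x := by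
  rw [AffineSubspace.mem_mk', Submodule.mem_orthogonal_singleton_iff_inner_left]
  simp [inner_sub_left, inner_smul_left, hθ, sub_eq_zero]

/-- A point s • y at height x equals x times the gnomonic image of y, and ⟨y, θ⟩ ≤ 1 forces x < 1.
This is the upper estimate of the slices in Fubini's theorem along θ. -/
theorem cone_slice_subset {θ : V} {A : Set V} {η : ℝ} (hθ : ‖θ‖ = 1) (hη1 : η < 1)
    (hA : A ⊆ {x | ‖x‖ = 1 ∧ ‖x - θ‖ ≤ η}) (x : ℝ) :
    (Ioo (0 : ℝ) 1 • A) ∩ AffineSubspace.mk' (x • θ +ᵥ (0 : V)) (ℝ ∙ θ)ᗮ ⊆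
      {_y | x ∈ Ioo (0 : ℝ) 1} ∩ x • ((fun x : V => (inner ℝ x θ)⁻¹ • x) '' A) := by
  rintro _ ⟨⟨s, hs, y, hy, rfl⟩, h⟩
  have h : inner ℝ (s • y) θ = x := (mem_mk'_orthogonal_iff hθ x _).1 h
  have hb := one_sub_le_inner_of_norm_sub_le hθ (hA hy).2
  have hb0 : 0 < inner ℝ y θ := by linarith
  have hb1 : inner ℝ y θ ≤ 1 := by
    simpa [(hA hy).1, hθ] using real_inner_le_norm y θ
  rw [inner_smul_left] at h
  simp only [conj_trivial] at h
  refine ⟨?_, ?_⟩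
  · subst h
    exact ⟨mul_pos hs.1 hb0, by nlinarith [hs.1, hs.2]⟩
  · refine ⟨_, ⟨y, hy, rfl⟩, ?_⟩
    simp only [smul_smul]
    rw [← h, mul_assoc, mul_inv_cancel₀ hb0.ne', mul_one]

/-- On the cap ⟨y, θ⟩ ≥ 1 - η, so below height 1 - η no ray of the cone has ended yet and the slice
is complete. -/
theorem subset_cone_slice {θ : V} {A : Set V} {η : ℝ} (hθ : ‖θ‖ = 1) (hη1 : η < 1)
    (hA : A ⊆ {x | ‖x‖ = 1 ∧ ‖x - θ‖ ≤ η}) {x : ℝ} (hx : x ∈ Ioo 0 (1 - η)) :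
    x • ((fun x : V => (inner ℝ x θ)⁻¹ • x) '' A) ⊆
      (Ioo (0 : ℝ) 1 • A) ∩ AffineSubspace.mk' (x • θ +ᵥ (0 : V)) (ℝ ∙ θ)ᗮ := by
  rintro _ ⟨_, ⟨y, hy, rfl⟩, rfl⟩
  have hb := one_sub_le_inner_of_norm_sub_le hθ (hA hy).2
  have hb0 : 0 < inner ℝ y θ := by linarith
  refine ⟨⟨x * (inner ℝ y θ)⁻¹, ⟨mul_pos hx.1 (inv_pos.2 hb0), ?_⟩, y, hy, ?_⟩, ?_⟩
  · rw [← div_eq_mul_inv, div_lt_one hb0]; linarith [hx.2]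
  · simp only [smul_smul]
  · refine (mem_mk'_orthogonal_iff hθ x _).2 ?_
    simp only [inner_smul_left, conj_trivial]
    rw [inv_mul_cancel₀ hb0.ne', mul_one]

theorem image_normalize_gnomonic {θ : V} {A : Set V} {η : ℝ} (hθ : ‖θ‖ = 1) (hη1 : η < 1)
    (hA : A ⊆ {x | ‖x‖ = 1 ∧ ‖x - θ‖ ≤ η}) :
    (fun y : V => ‖y‖⁻¹ • y) '' ((fun x : V => (inner ℝ x θ)⁻¹ • x) '' A) = A ∧
    ((fun x : V => (inner ℝ x θ)⁻¹ • x) '' A) ⊆ {y | 1 ≤ ‖y‖} := by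
  have key : ∀ x ∈ A, 0 < (inner ℝ x θ) ∧ ‖(inner ℝ x θ)⁻¹ • x‖ = (inner ℝ x θ)⁻¹ := by
    intro x hx
    have hb := one_sub_le_inner_of_norm_sub_le hθ (hA hx).2
    have hb0 : 0 < inner ℝ x θ := by linarith
    refine ⟨hb0, ?_⟩
    rw [norm_smul, (hA hx).1, mul_one, Real.norm_of_nonneg (by positivity)]
  constructor
  · rw [image_image]
    refine (image_congr fun x hx => ?_).trans (image_id A)
    obtain ⟨h1, h2⟩ := key x hx
    rw [h2, inv_inv, smul_smul, mul_inv_cancel₀ h1.ne', one_smul, id]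
  · rintro _ ⟨x, hx, rfl⟩
    obtain ⟨h1, h2⟩ := key x hx
    rw [mem_ofPred_eq, h2]
    refine (one_le_inv₀ h1).2 ?_
    simpa [(hA hx).1, hθ] using real_inner_le_norm x θ

end Gnomonic

/-! ### Hausdorff measure and cone measure on the unit sphere -/

section SphereMeasure

theorem measure_slice_smul {V : Type*} [NormedAddCommGroup V] [InnerProductSpace ℝ V]
    [MeasurableSpace V] [BorelSpace V] (d : ℕ) (K : Set V) {x : ℝ} (hx : 0 < x) :
    μHE[d] (x • K) = ENNReal.ofReal (x ^ d) * μHE[d] K := by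
  rw [Measure.euclideanHausdorffMeasure_smul₀ d hx.ne', ENNReal.smul_def, smul_eq_mul]
  congr 1
  rw [ENNReal.coe_pow, ENNReal.ofReal_pow hx.le]
  congr 1
  exact Real.enorm_of_nonneg hx.le

variable {V : Type*} [NormedAddCommGroup V] [InnerProductSpace ℝ V] [MeasurableSpace V]
  [BorelSpace V] [FiniteDimensional ℝ V]

theorem euclideanHausdorffMeasure_image_le {X Y : Type*} [EMetricSpace X] [MeasurableSpace X]
    [BorelSpace X] [EMetricSpace Y] [MeasurableSpace Y] [BorelSpace Y] {f : X → Y} {K : NNReal}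
    {s : Set X} (h : LipschitzOnWith K f s) (d : ℕ) :
    μHE[d] (f '' s) ≤ (K : ENNReal) ^ d * μHE[d] s := by
  simp only [Measure.euclideanHausdorffMeasure_def, Measure.smul_apply, ENNReal.smul_def,
    smul_eq_mul]
  have := h.hausdorffMeasure_image_le (d := (d : ℝ)) (by positivity)
  rw [ENNReal.rpow_natCast] at this
  calc _ ≤ _ := mul_le_mul_right this _
    _ = _ := by ring

theorem lintegral_Ioo_pow (k : ℕ) {t : ℝ} (ht : 0 ≤ t) :
    ∫⁻ x in Ioo 0 t, ENNReal.ofReal (x ^ k) = ENNReal.ofReal (t ^ (k + 1) / (k + 1)) := by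
  rw [Measure.restrict_congr_set Ioo_ae_eq_Ioc,
    ← ofReal_integral_eq_lintegral_ofReal (intervalIntegral.intervalIntegrable_pow _).1,
    ← intervalIntegral.integral_of_le ht]
  · simp
  · filter_upwards [ae_restrict_mem measurableSet_Ioc] with y hy
    exact pow_nonneg hy.1.le _

theorem measurableSet_Ioo_smul {A : Set V} (hA : MeasurableSet A) (hA1 : ∀ x ∈ A, ‖x‖ = 1) :
    MeasurableSet (Ioo (0 : ℝ) 1 • A) := by
  have : Ioo (0 : ℝ) 1 • A = {y : V | ‖y‖ ∈ Ioo (0 : ℝ) 1} ∩ (fun y => ‖y‖⁻¹ • y) ⁻¹' A := by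
    ext y
    simp only [Set.mem_smul, mem_inter_iff, mem_ofPred_eq, mem_preimage]
    constructor
    · rintro ⟨s, hs, x, hx, rfl⟩
      have : ‖s • x‖ = s := by rw [norm_smul, hA1 x hx, mul_one, Real.norm_of_nonneg hs.1.le]
      rw [this, smul_smul, inv_mul_cancel₀ hs.1.ne', one_smul]
      exact ⟨hs, hx⟩
    · rintro ⟨h1, h2⟩
      exact ⟨‖y‖, h1, _, h2, by simp only [smul_smul]; rw [mul_inv_cancel₀ h1.1.ne', one_smul]⟩
  rw [this]
  exact (measurable_norm measurableSet_Ioo).inter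
    ((measurable_norm.inv.smul measurable_id) hA)

/-- Slicing orthogonally to θ, the slice at height x has measure at most x^(d-1) times that of the
gnomonic image; the integral of x^(d-1) over (0, 1) is 1/d. -/
theorem cone_measure_le {θ : V} {A : Set V} {η : ℝ} (hθ : ‖θ‖ = 1) (hη1 : η < 1)
    (hAm : MeasurableSet A) (hA : A ⊆ {x | ‖x‖ = 1 ∧ ‖x - θ‖ ≤ η}) :
    (Module.finrank ℝ V : ENNReal) * μHE[Module.finrank ℝ V] (Ioo (0 : ℝ) 1 • A) ≤
      μHE[Module.finrank ℝ V - 1] ((fun x : V => (inner ℝ x θ)⁻¹ • x) '' A) := by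
  have hθ0 : θ ≠ 0 := by rintro rfl; simp at hθ
  have : Nontrivial V := ⟨⟨θ, 0, hθ0⟩⟩
  have hd : 0 < Module.finrank ℝ V := Module.finrank_pos
  rw [EuclideanGeometry.euclideanHausdorffMeasure_eq_lintegral (0 : V) hθ0
    (measurableSet_Ioo_smul hAm fun x hx => (hA hx).1)]
  obtain ⟨k, hk⟩ : ∃ k, Module.finrank ℝ V = k + 1 := ⟨_, (Nat.succ_pred_eq_of_pos hd).symm⟩
  rw [hk, Nat.add_sub_cancel]
  set K := (fun x : V => (inner ℝ x θ)⁻¹ • x) '' A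
  have hle : ∀ x : ℝ, μHE[k] ((Ioo (0 : ℝ) 1 • A) ∩
      (AffineSubspace.mk' (x • θ +ᵥ (0 : V)) (ℝ ∙ θ)ᗮ : Set V)) ≤
      (Ioo (0 : ℝ) 1).indicator (fun x => ENNReal.ofReal (x ^ k) * μHE[k] K) x := by
    intro x
    by_cases hx : x ∈ Ioo (0 : ℝ) 1
    · rw [indicator_of_mem hx, ← measure_slice_smul _ _ hx.1]
      exact measure_mono ((cone_slice_subset hθ hη1 hA x).trans inter_subset_right)
    · rw [indicator_of_notMem hx]
      refine le_of_eq (measure_mono_null (cone_slice_subset hθ hη1 hA x) ?_)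
      simp [hx]
  have hθe : ‖θ‖ₑ = 1 := by rw [← ofReal_norm, hθ, ENNReal.ofReal_one]
  rw [hθe, one_mul]
  calc _ ≤ ((k + 1 : ℕ) : ENNReal) *
        ∫⁻ x, (Ioo (0 : ℝ) 1).indicator (fun x => ENNReal.ofReal (x ^ k) * μHE[k] K) x :=
        mul_le_mul' le_rfl (lintegral_mono hle)
    _ = ((k + 1 : ℕ) : ENNReal) * (ENNReal.ofReal (1 / (k + 1)) * μHE[k] K) := by
        rw [lintegral_indicator measurableSet_Ioo, lintegral_mul_const _ (by fun_prop),
          lintegral_Ioo_pow k zero_le_one, one_pow]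
    _ = μHE[k] K := by
        rw [← mul_assoc, ← ENNReal.ofReal_natCast, ← ENNReal.ofReal_mul (by positivity)]
        rw [show ((k + 1 : ℕ) : ℝ) * (1 / (k + 1)) = 1 by push_cast; field_simp]
        simp

/-- Only the complete slices, at heights below 1 - η, are kept; their heights integrate to (1 - η)^d
/ d. -/
theorem le_cone_measure {θ : V} {A : Set V} {η : ℝ} (hθ : ‖θ‖ = 1) (hη1 : η < 1)
    (hAm : MeasurableSet A) (hA : A ⊆ {x | ‖x‖ = 1 ∧ ‖x - θ‖ ≤ η}) :
    ENNReal.ofReal ((1 - η) ^ Module.finrank ℝ V) *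
      μHE[Module.finrank ℝ V - 1] ((fun x : V => (inner ℝ x θ)⁻¹ • x) '' A) ≤
    (Module.finrank ℝ V : ENNReal) * μHE[Module.finrank ℝ V] (Ioo (0 : ℝ) 1 • A) := by
  have hθ0 : θ ≠ 0 := by rintro rfl; simp at hθ
  have : Nontrivial V := ⟨⟨θ, 0, hθ0⟩⟩
  have hd : 0 < Module.finrank ℝ V := Module.finrank_pos
  rw [EuclideanGeometry.euclideanHausdorffMeasure_eq_lintegral (0 : V) hθ0
    (measurableSet_Ioo_smul hAm fun x hx => (hA hx).1)]
  obtain ⟨k, hk⟩ : ∃ k, Module.finrank ℝ V = k + 1 := ⟨_, (Nat.succ_pred_eq_of_pos hd).symm⟩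
  rw [hk, Nat.add_sub_cancel]
  set K := (fun x : V => (inner ℝ x θ)⁻¹ • x) '' A
  have hle : ∀ x : ℝ, (Ioo (0 : ℝ) (1 - η)).indicator
      (fun x => ENNReal.ofReal (x ^ k) * μHE[k] K) x ≤ μHE[k] ((Ioo (0 : ℝ) 1 • A) ∩
      (AffineSubspace.mk' (x • θ +ᵥ (0 : V)) (ℝ ∙ θ)ᗮ : Set V)) := by
    intro x
    by_cases hx : x ∈ Ioo (0 : ℝ) (1 - η)
    · rw [indicator_of_mem hx, ← measure_slice_smul _ _ hx.1]
      exact measure_mono (subset_cone_slice hθ hη1 hA hx)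
    · rw [indicator_of_notMem hx]
      exact zero_le
  have hθe : ‖θ‖ₑ = 1 := by rw [← ofReal_norm, hθ, ENNReal.ofReal_one]
  rw [hθe, one_mul]
  have hη' : 0 ≤ 1 - η := by linarith
  calc _ = ((k + 1 : ℕ) : ENNReal) *
        (ENNReal.ofReal ((1 - η) ^ (k + 1) / (k + 1)) * μHE[k] K) := by
        rw [← mul_assoc, ← ENNReal.ofReal_natCast, ← ENNReal.ofReal_mul (by positivity)]
        rw [show ((k + 1 : ℕ) : ℝ) * ((1 - η) ^ (k + 1) / (k + 1)) = (1 - η) ^ (k + 1) by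
          push_cast; field_simp]
    _ = ((k + 1 : ℕ) : ENNReal) * ∫⁻ x, (Ioo (0 : ℝ) (1 - η)).indicator
          (fun x => ENNReal.ofReal (x ^ k) * μHE[k] K) x := by
        rw [lintegral_indicator measurableSet_Ioo, lintegral_mul_const _ (by fun_prop),
          lintegral_Ioo_pow k hη']
    _ ≤ _ := by exact mul_le_mul' le_rfl (lintegral_mono hle)

/-- On a small spherical cap the Hausdorff measure and the cone measure almost agree. -/
theorem sphere_cap_measures_comparable {θ : V} {A : Set V} {η : ℝ} (hθ : ‖θ‖ = 1) (hη : 0 < η)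
    (hη1 : η < 1) (hAm : MeasurableSet A) (hA : A ⊆ {x | ‖x‖ = 1 ∧ ‖x - θ‖ ≤ η}) :
    μHE[Module.finrank ℝ V - 1] A ≤ ENNReal.ofReal ((1 - η)⁻¹ ^ (2 * Module.finrank ℝ V)) *
      ((Module.finrank ℝ V : ENNReal) * μHE[Module.finrank ℝ V] (Ioo (0 : ℝ) 1 • A)) ∧
    (Module.finrank ℝ V : ENNReal) * μHE[Module.finrank ℝ V] (Ioo (0 : ℝ) 1 • A) ≤
      ENNReal.ofReal ((1 - η)⁻¹ ^ (2 * Module.finrank ℝ V)) * μHE[Module.finrank ℝ V - 1] A := by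
  obtain ⟨hK, hK1⟩ := image_normalize_gnomonic hθ hη1 hA
  have h1 := euclideanHausdorffMeasure_image_le (lipschitzOnWith_normalize.mono hK1)
    (Module.finrank ℝ V - 1)
  have h2 := euclideanHausdorffMeasure_image_le ((lipschitzOnWith_gnomonic hθ hη hη1).mono hA)
    (Module.finrank ℝ V - 1)
  have h3 := cone_measure_le hθ hη1 hAm hA
  have h4 := le_cone_measure hθ hη1 hAm hA
  rw [hK, ENNReal.coe_one, one_pow, one_mul] at h1
  set d := Module.finrank ℝ V
  set M := μHE[d - 1] ((fun x : V => (inner ℝ x θ)⁻¹ • x) '' A)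
  have hη' : 0 < 1 - η := by linarith
  have hinv : 1 ≤ (1 - η)⁻¹ := (one_le_inv₀ hη').2 (by linarith)
  -- The first bound needs the exponent d and the second 2(d - 1); 2d covers both because (1 - η)⁻¹
  -- ≥ 1.
  constructor
  · calc μHE[d - 1] A ≤ M := h1
      _ = ENNReal.ofReal ((1 - η)⁻¹ ^ d) * (ENNReal.ofReal ((1 - η) ^ d) * M) := by
          rw [← mul_assoc, ← ENNReal.ofReal_mul (by positivity), ← mul_pow,
            inv_mul_cancel₀ hη'.ne']
          simp
      _ ≤ ENNReal.ofReal ((1 - η)⁻¹ ^ (2 * d)) * _ := by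
          refine mul_le_mul' (ENNReal.ofReal_le_ofReal ?_) h4
          exact pow_le_pow_right₀ hinv (by omega)
  · refine h3.trans (h2.trans ?_)
    refine mul_le_mul' ?_ le_rfl
    rw [← ENNReal.ofReal_coe_nnreal, Real.coe_toNNReal _ (by positivity),
      ← ENNReal.ofReal_pow (by positivity), ← pow_mul]
    exact ENNReal.ofReal_le_ofReal (pow_le_pow_right₀ hinv (by omega))

/-- The `(d-1)`-dimensional Euclidean Hausdorff measure on the unit sphere of a `d`-dimensional
space is the surface measure of polar coordinates. -/
theorem euclideanHausdorffMeasure_sphere :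
    (μHE[Module.finrank ℝ V - 1] : Measure (Metric.sphere (0 : V) 1)) =
      (μHE[Module.finrank ℝ V] : Measure V).toSphere := by
  set d := Module.finrank ℝ V
  set μ : Measure (Metric.sphere (0 : V) 1) := μHE[d - 1]
  set ν : Measure (Metric.sphere (0 : V) 1) := (μHE[d] : Measure V).toSphere
  have hloc : ∀ η : ℝ, 0 < η → η < 1 → ∀ A : Set (Metric.sphere (0 : V) 1), MeasurableSet A →
      μ A ≤ ENNReal.ofReal ((1 - η)⁻¹ ^ (2 * d)) * ν A ∧
      ν A ≤ ENNReal.ofReal ((1 - η)⁻¹ ^ (2 * d)) * μ A := by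
    intro η hη hη1
    have key : ∀ x : Metric.sphere (0 : V) 1, ∀ A : Set (Metric.sphere (0 : V) 1),
        MeasurableSet A → A ⊆ Metric.closedBall x η →
        μ A ≤ ENNReal.ofReal ((1 - η)⁻¹ ^ (2 * d)) * ν A ∧
        ν A ≤ ENNReal.ofReal ((1 - η)⁻¹ ^ (2 * d)) * μ A := by
      intro x A hA hAx
      have hx : ‖(x : V)‖ = 1 := by simp
      have := sphere_cap_measures_comparable (A := Subtype.val '' A) hx hη hη1
        (MeasurableSet.subtype_image Metric.isClosed_sphere.measurableSet hA) (by
          rintro _ ⟨y, hy, rfl⟩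
          refine ⟨by simp, ?_⟩
          rw [← dist_eq_norm]
          exact hAx hy)
      rw [isometry_subtype_coe.euclideanHausdorffMeasure_image] at this
      have hν : ν A = d * μHE[d] (Ioo (0 : ℝ) 1 • (Subtype.val '' A)) :=
        Measure.toSphere_apply' _ hA
      rw [hν]
      exact this
    intro A hA
    exact ⟨measure_le_smul_of_forall_small μ ν _ η hη (fun x A hA h => (key x A hA h).1) A hA,
      measure_le_smul_of_forall_small ν μ _ η hη (fun x A hA h => (key x A hA h).2) A hA⟩
  -- The comparison holds for every set, with a constant depending only on η; letting η tend to 0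
  -- makes the constant 1.
  have hlim : Tendsto (fun η : ℝ => ENNReal.ofReal ((1 - η)⁻¹ ^ (2 * d))) (𝓝[>] 0) (𝓝 1) := by
    have : ContinuousAt (fun η : ℝ => ENNReal.ofReal ((1 - η)⁻¹ ^ (2 * d))) 0 :=
      ENNReal.continuous_ofReal.continuousAt.comp
        (((continuousAt_const.sub continuousAt_id).inv₀ (by norm_num)).pow _)
    have h := this.tendsto
    simp only [sub_zero, inv_one, one_pow, ENNReal.ofReal_one] at h
    exact h.mono_left nhdsWithin_le_nhds
  have hev : ∀ᶠ η : ℝ in 𝓝[>] 0, 0 < η ∧ η < 1 :=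
    Ioo_mem_nhdsGT (zero_lt_one' ℝ)
  ext A hA
  apply le_antisymm
  · have := ENNReal.Tendsto.mul_const hlim (b := ν A) (Or.inl one_ne_zero)
    rw [one_mul] at this
    exact ge_of_tendsto this (hev.mono fun η hη => (hloc η hη.1 hη.2 A hA).1)
  · have := ENNReal.Tendsto.mul_const hlim (b := μ A) (Or.inl one_ne_zero)
    rw [one_mul] at this
    exact ge_of_tendsto this (hev.mono fun η hη => (hloc η hη.1 hη.2 A hA).2)

end SphereMeasure

/-! ### Polar coordinates on balls and spheres -/

section Polar

variable {n : ℕ}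

/-- The surface measure of a sphere is the scaled image of the surface measure of polar
coordinates. -/
theorem boundaryMeasure_ball (x₀ : EuclideanSpace ℝ (Fin n)) {ρ : ℝ} (hρ : 0 < ρ) :
    boundaryMeasure (Metric.ball x₀ ρ) = ENNReal.ofReal (ρ ^ (n - 1)) •
      ((volume : Measure (EuclideanSpace ℝ (Fin n))).toSphere).map
        (fun θ : Metric.sphere (0 : EuclideanSpace ℝ (Fin n)) 1 => x₀ + ρ • (θ : _)) := by
  have hS := euclideanHausdorffMeasure_sphere (V := EuclideanSpace ℝ (Fin n))
  rw [finrank_euclideanSpace_fin, EuclideanSpace.euclideanHausdorffMeasure_eq_volume] at hS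
  rw [← hS, boundaryMeasure, frontier_ball x₀ hρ.ne']
  have hmeas : Measurable
      (fun θ : Metric.sphere (0 : EuclideanSpace ℝ (Fin n)) 1 =>
        x₀ + ρ • (θ : EuclideanSpace ℝ (Fin n))) :=
    (measurable_subtype_coe.const_smul ρ).const_add x₀
  have hi : ∀ B : Set (Metric.sphere (0 : EuclideanSpace ℝ (Fin n)) 1),
      μHE[n - 1] (Subtype.val '' B) = μHE[n - 1] B :=
    fun B => isometry_subtype_coe.euclideanHausdorffMeasure_image B
  ext A hA
  rw [Measure.restrict_apply hA, Measure.smul_apply, Measure.map_apply hmeas hA,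
    ← hi, smul_eq_mul,
    ← measure_slice_smul _ _ hρ,
    ← (IsometryEquiv.addLeft x₀).isometry.euclideanHausdorffMeasure_image (ρ • _)]
  congr 1
  ext y
  constructor
  · rintro ⟨hy, hy'⟩
    have hn : ‖y - x₀‖ = ρ := by rw [← dist_eq_norm]; exact hy'
    have e : x₀ + ρ • (ρ⁻¹ • (y - x₀)) = y := by
      rw [smul_smul, mul_inv_cancel₀ hρ.ne', one_smul, add_sub_cancel]
    have hs : ρ⁻¹ • (y - x₀) ∈ Metric.sphere (0 : EuclideanSpace ℝ (Fin n)) 1 := by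
      rw [mem_sphere_zero_iff_norm, norm_smul, hn, norm_inv, Real.norm_of_nonneg hρ.le,
        inv_mul_cancel₀ hρ.ne']
    refine ⟨ρ • (ρ⁻¹ • (y - x₀)), ⟨_, ⟨⟨_, hs⟩, ?_, rfl⟩, rfl⟩, e⟩
    rw [mem_preimage]
    exact e.symm ▸ hy
  · rintro ⟨_, ⟨_, ⟨θ, hθ, rfl⟩, rfl⟩, rfl⟩
    refine ⟨hθ, ?_⟩
    have : ‖(θ : EuclideanSpace ℝ (Fin n))‖ = 1 := by simp
    simp [norm_smul, this, hρ.le]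

theorem isFiniteMeasure_boundaryMeasure_ball (x₀ : EuclideanSpace ℝ (Fin n)) {ρ : ℝ}
    (hρ : 0 < ρ) : IsFiniteMeasure (boundaryMeasure (Metric.ball x₀ ρ)) := by
  rw [boundaryMeasure_ball x₀ hρ]
  exact Measure.smul_finite _ ENNReal.ofReal_ne_top

theorem integral_boundaryMeasure_ball (x₀ : EuclideanSpace ℝ (Fin n)) {ρ : ℝ}
    (hρ : 0 < ρ) {f : EuclideanSpace ℝ (Fin n) → ℝ} (hf : Continuous f) :
    ∫ x, f x ∂(boundaryMeasure (Metric.ball x₀ ρ)) = ρ ^ (n - 1) *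
      ∫ θ, f (x₀ + ρ • (θ : EuclideanSpace ℝ (Fin n)))
        ∂((volume : Measure (EuclideanSpace ℝ (Fin n))).toSphere) := by
  rw [boundaryMeasure_ball x₀ hρ, integral_smul_measure, integral_map,
    ENNReal.toReal_ofReal (by positivity), smul_eq_mul]
  · exact ((measurable_subtype_coe.const_smul ρ).const_add x₀).aemeasurable
  · exact hf.aestronglyMeasurable

theorem boundaryMeasure_ball_real_univ (x₀ : EuclideanSpace ℝ (Fin n)) {ρ : ℝ}
    (hρ : 0 < ρ) : (boundaryMeasure (Metric.ball x₀ ρ)).real univ = ρ ^ (n - 1) *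
      (volume : Measure (EuclideanSpace ℝ (Fin n))).toSphere.real univ := by
  have := integral_boundaryMeasure_ball x₀ hρ (f := fun _ => 1) continuous_const
  simpa using this

/-- Polar coordinates. -/
theorem integral_eq_integral_sphere (hn : 1 ≤ n) {F : EuclideanSpace ℝ (Fin n) → ℝ}
    (hF : Integrable F) :
    ∫ x, F x = ∫ θ, (∫ r in Ioi (0 : ℝ), r ^ (n - 1) * F (r • (θ : EuclideanSpace ℝ (Fin n))))
      ∂((volume : Measure (EuclideanSpace ℝ (Fin n))).toSphere) := by
  have : NeZero n := ⟨by omega⟩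
  let μ : Measure (EuclideanSpace ℝ (Fin n)) := volume
  have hmp := μ.measurePreserving_homeomorphUnitSphereProd
  have hemb := (homeomorphUnitSphereProd (EuclideanSpace ℝ (Fin n))).measurableEmbedding
  let Φ : Metric.sphere (0 : EuclideanSpace ℝ (Fin n)) 1 × Ioi (0 : ℝ) → ℝ :=
    fun q => F ((q.2 : ℝ) • (q.1 : EuclideanSpace ℝ (Fin n)))
  have hΦ : ∀ x : ({0}ᶜ : Set (EuclideanSpace ℝ (Fin n))),
      Φ (homeomorphUnitSphereProd _ x) = F x := by
    intro x
    have hx : ‖(x : EuclideanSpace ℝ (Fin n))‖ ≠ 0 := norm_ne_zero_iff.2 x.2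
    simp [Φ, smul_smul, hx]
  have hint : Integrable Φ (μ.toSphere.prod (.volumeIoiPow (n - 1))) := by
    rw [finrank_euclideanSpace_fin] at hmp
    rw [← hmp.integrable_comp_emb hemb]
    have : (Φ ∘ homeomorphUnitSphereProd _) = F ∘ Subtype.val := funext hΦ
    rw [this, ← integrableOn_iff_comap_subtypeVal (measurableSet_singleton _).compl]
    exact hF.integrableOn
  calc ∫ x, F x = ∫ x : ({(0)}ᶜ : Set (EuclideanSpace ℝ (Fin n))), F x ∂(μ.comap (↑)) := by
        rw [integral_subtype_comap (measurableSet_singleton _).compl F, restrict_compl_singleton]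
    _ = ∫ q, Φ q ∂μ.toSphere.prod (.volumeIoiPow (n - 1)) := by
        rw [finrank_euclideanSpace_fin] at hmp
        rw [← hmp.integral_comp hemb]
        exact integral_congr_ae (.of_forall fun x => (hΦ x).symm)
    _ = ∫ θ, ∫ r, Φ (θ, r) ∂(.volumeIoiPow (n - 1)) ∂μ.toSphere := integral_prod _ hint
    _ = _ := by
        refine integral_congr_ae (.of_forall fun θ => ?_)
        simp only [Measure.volumeIoiPow, ENNReal.ofReal]
        rw [integral_withDensity_eq_integral_smul,
          integral_subtype_comap measurableSet_Ioi
            fun a : ℝ ↦ Real.toNNReal (a ^ (n - 1)) • F (a • (θ : EuclideanSpace ℝ (Fin n)))]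
        · refine setIntegral_congr_fun measurableSet_Ioi fun x hx => ?_
          simp only [NNReal.smul_def, smul_eq_mul]
          rw [Real.coe_toNNReal _ (pow_nonneg hx.out.le _)]
        · exact (measurable_subtype_coe.pow_const _).real_toNNReal

theorem setIntegral_ball_eq_integral_sphere (hn : 1 ≤ n) (x₀ : EuclideanSpace ℝ (Fin n)) {ρ : ℝ}
    {F : EuclideanSpace ℝ (Fin n) → ℝ} (hF : IntegrableOn F (Metric.ball x₀ ρ)) :
    ∫ x in Metric.ball x₀ ρ, F x =
      ∫ θ, (∫ r in Ioo (0 : ℝ) ρ, r ^ (n - 1) * F (x₀ + r • (θ : EuclideanSpace ℝ (Fin n))))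
      ∂((volume : Measure (EuclideanSpace ℝ (Fin n))).toSphere) := by
  have hF' : Integrable ((Metric.ball x₀ ρ).indicator F) :=
    (integrable_indicator_iff Metric.isOpen_ball.measurableSet).2 hF
  rw [← integral_indicator Metric.isOpen_ball.measurableSet,
    ← integral_add_left_eq_self _ x₀, integral_eq_integral_sphere hn (hF'.comp_add_left x₀)]
  refine integral_congr_ae (.of_forall fun θ => ?_)
  simp only
  have hθ : ‖(θ : EuclideanSpace ℝ (Fin n))‖ = 1 := by simp
  rw [← integral_indicator measurableSet_Ioi, ← integral_indicator measurableSet_Ioo]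
  congr 1
  ext r
  by_cases hr : 0 < r
  · by_cases hr' : r < ρ
    · have h1 : x₀ + r • (θ : EuclideanSpace ℝ (Fin n)) ∈ Metric.ball x₀ ρ := by
        simp [norm_smul, hθ, abs_of_pos hr, hr']
      rw [indicator_of_mem (mem_Ioi.2 hr), indicator_of_mem (mem_Ioo.2 ⟨hr, hr'⟩),
        indicator_of_mem h1]
    · have h1 : x₀ + r • (θ : EuclideanSpace ℝ (Fin n)) ∉ Metric.ball x₀ ρ := by
        simpa [norm_smul, hθ, abs_of_pos hr] using hr'
      rw [indicator_of_mem (mem_Ioi.2 hr), indicator_of_notMem (fun h : r ∈ Ioo 0 ρ => hr' h.2),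
        indicator_of_notMem h1, mul_zero]
  · rw [indicator_of_notMem (fun h : r ∈ Ioi 0 => hr h),
      indicator_of_notMem (fun h : r ∈ Ioo 0 ρ => hr h.1)]

/-- Integrals of radial functions over balls. -/
theorem setIntegral_ball_radial (hn : 1 ≤ n) (x₀ : EuclideanSpace ℝ (Fin n)) {ρ : ℝ}
    {k : ℝ → ℝ} (hk : IntegrableOn (fun x => k ‖x - x₀‖) (Metric.ball x₀ ρ)) :
    ∫ x in Metric.ball x₀ ρ, k ‖x - x₀‖ =
      (volume : Measure (EuclideanSpace ℝ (Fin n))).toSphere.real univ *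
        ∫ r in Ioo (0 : ℝ) ρ, r ^ (n - 1) * k r := by
  rw [setIntegral_ball_eq_integral_sphere hn x₀ hk, ← smul_eq_mul, ← integral_const]
  refine integral_congr_ae (.of_forall fun θ => ?_)
  refine setIntegral_congr_fun measurableSet_Ioo fun r hr => ?_
  have hθ : ‖(θ : EuclideanSpace ℝ (Fin n))‖ = 1 := by simp
  simp [norm_smul, hθ, abs_of_pos hr.1]

theorem toSphere_real_univ_pos (hn : 1 ≤ n) :
    0 < (volume : Measure (EuclideanSpace ℝ (Fin n))).toSphere.real univ := by
  have : NeZero n := ⟨by omega⟩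
  rw [measureReal_def]
  exact ENNReal.toReal_pos (by
    rw [ne_eq, Measure.measure_univ_eq_zero]
    exact Measure.toSphere_ne_zero _) (measure_ne_top _ _)

end Polar

/-! ### Smooth functions as competitors -/

section Smooth

variable {n : ℕ}

theorem norm_gradient_eq_norm_fderiv (f : EuclideanSpace ℝ (Fin n) → ℝ)
    (x : EuclideanSpace ℝ (Fin n)) : ‖∇ f x‖ = ‖fderiv ℝ f x‖ := by
  rw [← toDual_gradient, LinearIsometryEquiv.norm_map]

theorem ContDiff.continuous_gradient' {f : EuclideanSpace ℝ (Fin n) → ℝ} (hf : ContDiff ℝ ∞ f) :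
    Continuous (∇ f) := by
  have : ∇ f = fun x => (InnerProductSpace.toDual ℝ _).symm (fderiv ℝ f x) := rfl
  rw [this]
  exact (LinearIsometryEquiv.continuous _).comp (hf.continuous_fderiv (by simp))

theorem Continuous.memLp_of_ae_mem_closedBall {F : Type*} [NormedAddCommGroup F]
    [SecondCountableTopology F]
    {f : EuclideanSpace ℝ (Fin n) → F} (hf : Continuous f) (q : ENNReal)
    (μ : Measure (EuclideanSpace ℝ (Fin n))) [IsFiniteMeasure μ] (x₀ : EuclideanSpace ℝ (Fin n))
    (ρ : ℝ) (hμ : ∀ᵐ x ∂μ, x ∈ Metric.closedBall x₀ ρ) : MemLp f q μ := by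
  obtain ⟨C, hC⟩ := (isCompact_closedBall x₀ ρ).exists_bound_of_continuousOn hf.continuousOn
  borelize F
  exact MemLp.of_bound hf.aestronglyMeasurable C (hμ.mono fun x hx => hC x hx)

theorem isFiniteMeasure_restrict_ball (x₀ : EuclideanSpace ℝ (Fin n)) (ρ : ℝ) :
    IsFiniteMeasure ((volume : Measure (EuclideanSpace ℝ (Fin n))).restrict (Metric.ball x₀ ρ)) :=
  ⟨by rw [Measure.restrict_apply_univ]; exact measure_ball_lt_top⟩

theorem ae_restrict_ball_mem_closedBall (x₀ : EuclideanSpace ℝ (Fin n)) (ρ : ℝ) :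
    ∀ᵐ x ∂((volume : Measure (EuclideanSpace ℝ (Fin n))).restrict (Metric.ball x₀ ρ)),
      x ∈ Metric.closedBall x₀ ρ :=
  (ae_restrict_mem Metric.isOpen_ball.measurableSet).mono fun _ hx => Metric.ball_subset_closedBall hx

theorem ae_boundaryMeasure_ball_mem_sphere (x₀ : EuclideanSpace ℝ (Fin n)) {ρ : ℝ} (hρ : 0 < ρ) :
    ∀ᵐ x ∂(boundaryMeasure (Metric.ball x₀ ρ)), x ∈ Metric.sphere x₀ ρ := by
  rw [boundaryMeasure, frontier_ball x₀ hρ.ne']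
  exact ae_restrict_mem Metric.isClosed_sphere.measurableSet

theorem Continuous.memLp_ball {F : Type*} [NormedAddCommGroup F] [SecondCountableTopology F]
    {f : EuclideanSpace ℝ (Fin n) → F} (hf : Continuous f) (q : ENNReal)
    (x₀ : EuclideanSpace ℝ (Fin n)) (ρ : ℝ) :
    MemLp f q (volume.restrict (Metric.ball x₀ ρ)) :=
  have := isFiniteMeasure_restrict_ball x₀ ρ
  hf.memLp_of_ae_mem_closedBall q _ x₀ ρ (ae_restrict_ball_mem_closedBall x₀ ρ)

theorem Continuous.memLp_boundaryMeasure_ball {F : Type*} [NormedAddCommGroup F]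
    [SecondCountableTopology F]
    {f : EuclideanSpace ℝ (Fin n) → F} (hf : Continuous f) (q : ENNReal)
    (x₀ : EuclideanSpace ℝ (Fin n)) {ρ : ℝ} (hρ : 0 < ρ) :
    MemLp f q (boundaryMeasure (Metric.ball x₀ ρ)) :=
  have := isFiniteMeasure_boundaryMeasure_ball x₀ hρ
  hf.memLp_of_ae_mem_closedBall q _ x₀ ρ
    ((ae_boundaryMeasure_ball_mem_sphere x₀ hρ).mono fun _ hx => Metric.sphere_subset_closedBall hx)

theorem isSobolevWithGradient_of_contDiff {f : EuclideanSpace ℝ (Fin n) → ℝ}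
    (hf : ContDiff ℝ ∞ f) (p : ℝ) (x₀ : EuclideanSpace ℝ (Fin n)) (ρ : ℝ) :
    IsSobolevWithGradient p (Metric.ball x₀ ρ) f (∇ f) where
  memLp := hf.continuous.memLp_ball _ x₀ ρ
  memLp_gradient := hf.continuous_gradient'.memLp_ball _ x₀ ρ
  integral_by_parts := by
    intro ψ hψ hψc hψs v
    -- The test function and its derivative vanish off the ball, so both integrals extend to the
    -- whole space, where integration by parts has no boundary term.
    have hd : ∀ x, x ∉ Metric.ball x₀ ρ → fderiv ℝ ψ x v = 0 := by
      intro x hx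
      have : fderiv ℝ ψ x = 0 :=
        image_eq_zero_of_notMem_tsupport fun h => hx (hψs (tsupport_fderiv_subset ℝ h))
      rw [this]; rfl
    have h0 : ∀ x, x ∉ Metric.ball x₀ ρ → ψ x = 0 := fun x hx =>
      image_eq_zero_of_notMem_tsupport fun h => hx (hψs h)
    have hcf : Continuous fun x => fderiv ℝ f x v :=
      (hf.continuous_fderiv (by simp)).clm_apply continuous_const
    have hcψ : Continuous fun x => fderiv ℝ ψ x v :=
      (hψ.continuous_fderiv (by simp)).clm_apply continuous_const
    have hcs : HasCompactSupport fun x => fderiv ℝ ψ x v := hψc.fderiv_apply ℝ v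
    rw [setIntegral_eq_integral_of_forall_compl_eq_zero fun x hx => by rw [hd x hx, mul_zero],
      setIntegral_eq_integral_of_forall_compl_eq_zero fun x hx => by rw [h0 x hx, mul_zero]]
    simp only [inner_gradient_left]
    exact integral_mul_fderiv_eq_neg_fderiv_mul_of_integrable
      ((hcf.mul hψ.continuous).integrable_of_hasCompactSupport hψc.mul_left)
      ((hf.continuous.mul hcψ).integrable_of_hasCompactSupport hcs.mul_left)
      ((hf.continuous.mul hψ.continuous).integrable_of_hasCompactSupport hψc.mul_left)
      (fun x _ => (hf.differentiable (by simp)).differentiableAt)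
      (fun x _ => (hψ.differentiable (by simp)).differentiableAt)

theorem isTrace_of_contDiff {f : EuclideanSpace ℝ (Fin n) → ℝ}
    (hf : ContDiff ℝ ∞ f) (p : ℝ) (x₀ : EuclideanSpace ℝ (Fin n)) {ρ : ℝ} (hρ : 0 < ρ) :
    IsTrace p (Metric.ball x₀ ρ) f (∇ f) f :=
  ⟨hf.continuous.memLp_boundaryMeasure_ball _ x₀ hρ, fun _ => f, fun _ => hf, by simp, by simp,
    by simp⟩

theorem bddBelow_insulationEnergy (β p : ℝ) (hβ : 0 ≤ β) (D Ω : Set (EuclideanSpace ℝ (Fin n))) :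
    BddBelow {E : ℝ | ∃ (φ : EuclideanSpace ℝ (Fin n) → ℝ)
      (G : EuclideanSpace ℝ (Fin n) → EuclideanSpace ℝ (Fin n))
      (g : EuclideanSpace ℝ (Fin n) → ℝ),
    IsSobolevWithGradient p Ω φ G ∧ IsTrace p Ω φ G g ∧
    (∀ᵐ x ∂(volume.restrict Ω), x ∈ D → 1 ≤ φ x) ∧
    E = (∫ x in Ω, ‖G x‖ ^ p) + β * ∫ x, |g x| ^ p ∂(boundaryMeasure Ω)} := by
  refine ⟨0, ?_⟩
  rintro E ⟨φ, G, g, -, -, -, rfl⟩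
  exact add_nonneg (integral_nonneg fun x => by positivity)
    (mul_nonneg hβ (integral_nonneg fun x => by positivity))

/-- Every smooth competitor bounds the insulation energy from above. -/
theorem insulationEnergy_le_of_contDiff {β p : ℝ} (hβ : 0 ≤ β) (D : Set (EuclideanSpace ℝ (Fin n)))
    (x₀ : EuclideanSpace ℝ (Fin n)) {ρ : ℝ} (hρ : 0 < ρ) {f : EuclideanSpace ℝ (Fin n) → ℝ}
    (hf : ContDiff ℝ ∞ f) (hfD : ∀ x ∈ D, 1 ≤ f x) :
    insulationEnergy β p D (Metric.ball x₀ ρ) ≤ (∫ x in Metric.ball x₀ ρ, ‖∇ f x‖ ^ p) +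
      β * ∫ x, |f x| ^ p ∂(boundaryMeasure (Metric.ball x₀ ρ)) :=
  csInf_le (bddBelow_insulationEnergy β p hβ D _)
    ⟨f, ∇ f, f, isSobolevWithGradient_of_contDiff hf p x₀ ρ, isTrace_of_contDiff hf p x₀ hρ,
      .of_forall hfD, rfl⟩

end Smooth

/-! ### Radial functions -/

section Radial

variable {n : ℕ}

/-- The norm fails to be smooth only at the centre, and near it the function is constant. -/
theorem contDiff_radial {h : ℝ → ℝ} (hh : ContDiff ℝ ∞ h) {R a : ℝ} (hR : 0 < R)
    (hc : ∀ r ≤ R, h r = a) (x₀ : EuclideanSpace ℝ (Fin n)) :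
    ContDiff ℝ ∞ fun x => h ‖x - x₀‖ := by
  rw [contDiff_iff_contDiffAt]
  intro x
  by_cases hx : x = x₀
  · subst hx
    refine (contDiffAt_const (c := a)).congr_of_eventuallyEq ?_
    filter_upwards [Metric.ball_mem_nhds x hR] with y hy
    exact hc _ (by rw [← dist_eq_norm]; exact (Metric.mem_ball.1 hy).le)
  · exact hh.contDiffAt.comp x ((contDiffAt_id.sub contDiffAt_const).norm ℝ (sub_ne_zero.2 hx))

theorem norm_gradient_radial_le {h : ℝ → ℝ} (hh : Differentiable ℝ h)
    {x₀ x : EuclideanSpace ℝ (Fin n)} (hx : x ≠ x₀) :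
    ‖∇ (fun x => h ‖x - x₀‖) x‖ ≤ |deriv h ‖x - x₀‖| := by
  have hN : DifferentiableAt ℝ (fun y => ‖y - x₀‖) x :=
    (differentiableAt_id.sub_const x₀).norm ℝ (sub_ne_zero.2 hx)
  have hlip : LipschitzWith 1 (fun y => ‖y - x₀‖) := by
    refine LipschitzWith.of_dist_le_mul fun y z => ?_
    rw [NNReal.coe_one, one_mul, Real.dist_eq, dist_eq_norm]
    simpa using abs_norm_sub_norm_le (y - x₀) (z - x₀)
  have : HasFDerivAt (fun x => h ‖x - x₀‖) _ x :=
    (hh ‖x - x₀‖).hasDerivAt.comp_hasFDerivAt x hN.hasFDerivAt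
  rw [norm_gradient_eq_norm_fderiv, this.fderiv, norm_smul, Real.norm_eq_abs]
  refine mul_le_of_le_one_right (abs_nonneg _) ?_
  simpa using norm_fderiv_le_of_lipschitz ℝ hlip

end Radial

/-! ### Smoothed radial profiles -/

section Profile

/-- The power `s ^ (-γ)`, smoothly cut off to vanish for `s ≤ R`. -/
noncomputable def cutoffPower (γ R ε s : ℝ) : ℝ :=
  s ^ (-γ) * Real.smoothTransition ((s - R) / ε)

theorem cutoffPower_of_le {γ R ε s : ℝ} (hε : 0 < ε) (hs : s ≤ R) : cutoffPower γ R ε s = 0 := by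
  rw [cutoffPower, Real.smoothTransition.zero_of_nonpos, mul_zero]
  exact div_nonpos_of_nonpos_of_nonneg (by linarith) hε.le

theorem cutoffPower_of_ge {γ R ε s : ℝ} (hε : 0 < ε) (hs : R + ε ≤ s) :
    cutoffPower γ R ε s = s ^ (-γ) := by
  rw [cutoffPower, Real.smoothTransition.one_of_one_le, mul_one]
  rw [le_div_iff₀ hε]; linarith

theorem cutoffPower_nonneg {γ R ε s : ℝ} (hR : 0 < R) (hε : 0 < ε) : 0 ≤ cutoffPower γ R ε s := by
  rcases le_total s R with hs | hs
  · rw [cutoffPower_of_le hε hs]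
  · exact mul_nonneg (Real.rpow_nonneg (hR.le.trans hs) _) (Real.smoothTransition.nonneg _)

theorem cutoffPower_le {γ R ε s : ℝ} (hs : 0 ≤ s) : cutoffPower γ R ε s ≤ s ^ (-γ) :=
  mul_le_of_le_one_right (Real.rpow_nonneg hs _) (Real.smoothTransition.le_one _)

theorem contDiff_cutoffPower {γ R ε : ℝ} (hR : 0 < R) (hε : 0 < ε) :
    ContDiff ℝ ∞ (cutoffPower γ R ε) := by
  rw [contDiff_iff_contDiffAt]
  intro s
  rcases lt_or_ge s R with hs | hs
  · refine (contDiffAt_const (c := (0 : ℝ))).congr_of_eventuallyEq ?_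
    filter_upwards [Iio_mem_nhds hs] with t ht using cutoffPower_of_le hε (le_of_lt ht)
  · refine (Real.contDiffAt_rpow_const_of_ne (hR.trans_le hs).ne').mul ?_
    exact Real.smoothTransition.contDiff.contDiffAt.comp s
      ((contDiffAt_id.sub contDiffAt_const).div_const _)

/-- A smooth radial profile close to the optimal one, equal to `1` for `r ≤ R`. -/
noncomputable def smoothProfile (γ R ε c r : ℝ) : ℝ :=
  1 - c * ∫ s in R..r, cutoffPower γ R ε s

theorem hasDerivAt_smoothProfile {γ R ε : ℝ} (hR : 0 < R) (hε : 0 < ε) (c r : ℝ) :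
    HasDerivAt (smoothProfile γ R ε c) (-(c * cutoffPower γ R ε r)) r := by
  have hc := (contDiff_cutoffPower (γ := γ) hR hε).continuous
  have := intervalIntegral.integral_hasDerivAt_right (hc.intervalIntegrable R r)
    hc.aestronglyMeasurable.stronglyMeasurableAtFilter hc.continuousAt
  exact (this.const_mul c).const_sub 1

theorem contDiff_smoothProfile {γ R ε : ℝ} (hR : 0 < R) (hε : 0 < ε) (c : ℝ) :
    ContDiff ℝ ∞ (smoothProfile γ R ε c) := by
  rw [contDiff_infty_iff_deriv]
  refine ⟨fun r => (hasDerivAt_smoothProfile hR hε c r).differentiableAt, ?_⟩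
  have : deriv (smoothProfile γ R ε c) = fun r => -(c * cutoffPower γ R ε r) :=
    funext fun r => (hasDerivAt_smoothProfile hR hε c r).deriv
  rw [this]
  exact (contDiff_const.mul (contDiff_cutoffPower hR hε)).neg

theorem smoothProfile_of_le {γ R ε c r : ℝ} (hε : 0 < ε) (hr : r ≤ R) :
    smoothProfile γ R ε c r = 1 := by
  rw [smoothProfile, intervalIntegral.integral_congr (g := fun _ => (0 : ℝ))]
  · simp
  · intro s hs
    rw [uIcc_of_ge hr] at hs
    exact cutoffPower_of_le hε hs.2

theorem intervalIntegrable_rpow_neg {γ a b : ℝ} (ha : 0 < a) (hb : 0 < b) :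
    IntervalIntegrable (fun s : ℝ => s ^ (-γ)) volume a b := by
  refine intervalIntegral.intervalIntegrable_rpow (Or.inr ?_)
  exact fun h => (lt_min ha hb).not_ge h.1

theorem integral_rpow_neg_le {γ a b : ℝ} (hγ : 0 ≤ γ) (ha : 0 < a) (hab : a ≤ b) :
    ∫ s in a..b, s ^ (-γ) ≤ (b - a) * a ^ (-γ) := by
  have := intervalIntegral.integral_mono_on hab (intervalIntegrable_rpow_neg ha (ha.trans_le hab))
    (intervalIntegrable_const (c := a ^ (-γ)))
    (fun s hs => Real.rpow_le_rpow_of_nonpos ha hs.1 (neg_nonpos.2 hγ))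
  simpa using this

/-- The cutoff changes the slope only on [R, R + ε], where s^(-γ) ≤ R^(-γ); hence an error of at
most c R^(-γ) ε in the boundary value. -/
theorem smoothProfile_bounds {γ R ε c ρ : ℝ} (hγ : 0 ≤ γ) (hR : 0 < R) (hε : 0 < ε) (hc : 0 ≤ c)
    (hρ : R + ε ≤ ρ) :
    1 - c * (∫ s in R..ρ, s ^ (-γ)) ≤ smoothProfile γ R ε c ρ ∧
    smoothProfile γ R ε c ρ ≤ 1 - c * (∫ s in R..ρ, s ^ (-γ)) + c * R ^ (-γ) * ε := by
  have hw := (contDiff_cutoffPower (γ := γ) hR hε).continuous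
  have hRρ : R ≤ ρ := by linarith
  have hi := intervalIntegrable_rpow_neg (γ := γ) hR (by linarith : 0 < R + ε)
  have hi' := intervalIntegrable_rpow_neg (γ := γ) (by linarith : 0 < R + ε)
    (by linarith : 0 < ρ)
  constructor
  · have : ∫ s in R..ρ, cutoffPower γ R ε s ≤ ∫ s in R..ρ, s ^ (-γ) :=
      intervalIntegral.integral_mono_on hRρ (hw.intervalIntegrable _ _)
        (intervalIntegrable_rpow_neg hR (by linarith))
        (fun s hs => cutoffPower_le (hR.le.trans hs.1))
    rw [smoothProfile]
    nlinarith
  · have h2 : 0 ≤ ∫ s in R..(R + ε), cutoffPower γ R ε s :=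
      intervalIntegral.integral_nonneg (by linarith) fun s _ => cutoffPower_nonneg hR hε
    have h3 : ∫ s in (R + ε)..ρ, cutoffPower γ R ε s = ∫ s in (R + ε)..ρ, s ^ (-γ) := by
      refine intervalIntegral.integral_congr fun s hs => ?_
      rw [uIcc_of_le hρ] at hs
      exact cutoffPower_of_ge hε hs.1
    have h4 := intervalIntegral.integral_add_adjacent_intervals
      (hw.intervalIntegrable (μ := volume) R (R + ε)) (hw.intervalIntegrable (R + ε) ρ)
    have h5 := intervalIntegral.integral_add_adjacent_intervals hi hi'
    have h6 := integral_rpow_neg_le hγ hR (by linarith : R ≤ R + ε)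
    rw [smoothProfile, ← h4, ← h5, h3]
    have := mul_le_mul_of_nonneg_left h6 hc
    have := mul_nonneg hc h2
    nlinarith

end Profile

/-! ### Upper bound by the optimal radial profile -/

section Upper

variable {n : ℕ}

/-- The exponent identity behind the optimal radial profile. -/
theorem pow_mul_rpow_neg_rpow (hn : 1 ≤ n) {p c r : ℝ} (hp : 1 < p) (hc : 0 ≤ c) (hr : 0 < r) :
    r ^ (n - 1) * (c * r ^ (-(((n : ℝ) - 1) / (p - 1)))) ^ p =
      c ^ p * r ^ (-(((n : ℝ) - 1) / (p - 1))) := by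
  rw [Real.mul_rpow hc (Real.rpow_nonneg hr.le _), ← Real.rpow_mul hr.le, ← Real.rpow_natCast,
    mul_left_comm, ← Real.rpow_add hr, Nat.cast_sub hn]
  congr 2
  have : p - 1 ≠ 0 := by linarith
  field_simp
  push_cast
  ring

theorem integrableOn_ball_cutoffPower {γ R ε c p : ℝ} (hR : 0 < R) (hε : 0 < ε) (hp : 0 ≤ p)
    (x₀ : EuclideanSpace ℝ (Fin n)) (ρ : ℝ) :
    IntegrableOn (fun x => (c * cutoffPower γ R ε ‖x - x₀‖) ^ p) (Metric.ball x₀ ρ) := by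
  have hw := (contDiff_cutoffPower (γ := γ) hR hε).continuous
  have : Continuous fun x : EuclideanSpace ℝ (Fin n) => (c * cutoffPower γ R ε ‖x - x₀‖) ^ p :=
    (continuous_const.mul (hw.comp (continuous_id.sub continuous_const).norm)).rpow_const
      fun _ => Or.inr hp
  exact memLp_one_iff_integrable.1 (this.memLp_ball 1 x₀ ρ)

/-- In polar coordinates the weight r^(n-1) turns the p-th power of c r^(-γ) into c^p r^(-γ). The
upper bound uses it with radius R, the lower bound with the smaller radius R - 2ε. -/
theorem setIntegral_ball_cutoffPower_le (hn : 1 ≤ n) {p R ρ c ε : ℝ} (hp : 1 < p)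
    (hR : 0 < R) (hc : 0 ≤ c) (hε : 0 < ε) (hρ : R ≤ ρ) (x₀ : EuclideanSpace ℝ (Fin n)) :
    ∫ x in Metric.ball x₀ ρ, (c * cutoffPower (((n : ℝ) - 1) / (p - 1)) R ε ‖x - x₀‖) ^ p ≤
      (volume : Measure (EuclideanSpace ℝ (Fin n))).toSphere.real univ *
        (c ^ p * ∫ s in R..ρ, s ^ (-(((n : ℝ) - 1) / (p - 1)))) := by
  have hγ := fun r : ℝ => pow_mul_rpow_neg_rpow (r := r) hn hp hc
  set γ := ((n : ℝ) - 1) / (p - 1)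
  have hw := (contDiff_cutoffPower (γ := γ) hR hε).continuous
  have hρ0 : 0 < ρ := hR.trans_le hρ
  have hk : Continuous fun r => (c * cutoffPower γ R ε r) ^ p :=
    (continuous_const.mul hw).rpow_const fun _ => Or.inr (by linarith)
  rw [setIntegral_ball_radial hn x₀ (k := fun r => (c * cutoffPower γ R ε r) ^ p)
    (integrableOn_ball_cutoffPower hR hε (by linarith) x₀ ρ)]
  refine mul_le_mul_of_nonneg_left ?_ measureReal_nonneg
  rw [setIntegral_eq_of_subset_of_forall_sdiff_eq_zero (s := Ioo R ρ) measurableSet_Ioo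
    (Ioo_subset_Ioo_left hR.le), ← integral_Ioc_eq_integral_Ioo,
    ← intervalIntegral.integral_of_le hρ, ← intervalIntegral.integral_const_mul]
  · refine intervalIntegral.integral_mono_on hρ
      ((((continuous_pow _).mul hk)).intervalIntegrable _ _)
      ((intervalIntegrable_rpow_neg hR hρ0).const_mul _) fun s hs => ?_
    have hs0 : 0 < s := hR.trans_le hs.1
    rw [← hγ s hs0]
    refine mul_le_mul_of_nonneg_left ?_ (by positivity)
    refine Real.rpow_le_rpow (mul_nonneg hc (cutoffPower_nonneg hR hε)) ?_ (by linarith)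
    exact mul_le_mul_of_nonneg_left (cutoffPower_le hs0.le) hc
  · intro r hr
    have : r ≤ R := by
      by_contra hcon
      exact hr.2 ⟨not_le.1 hcon, hr.1.2⟩
    rw [cutoffPower_of_le hε this, mul_zero, Real.zero_rpow (by linarith), mul_zero]

/-- The smoothed profile is an admissible competitor: its gradient is at most c times the cut-off
power, and its constant boundary value exceeds the ideal one by at most c R^(-γ) ε. The slope c is
still free. -/
theorem insulationEnergy_le_profile (hn : 1 ≤ n) {p β R ρ c ε : ℝ} (hp : 1 < p) (hβ : 0 ≤ β)
    (hR : 0 < R) (hc : 0 ≤ c) (hε : 0 < ε) (hρ : R + ε ≤ ρ) (x₀ : EuclideanSpace ℝ (Fin n))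
    (hm : 0 ≤ 1 - c * (∫ s in R..ρ, s ^ (-(((n : ℝ) - 1) / (p - 1))))) :
    insulationEnergy β p (Metric.closedBall x₀ R) (Metric.ball x₀ ρ) ≤
      (volume : Measure (EuclideanSpace ℝ (Fin n))).toSphere.real univ *
      (c ^ p * (∫ s in R..ρ, s ^ (-(((n : ℝ) - 1) / (p - 1)))) + β * (ρ ^ (n - 1) *
        (1 - c * (∫ s in R..ρ, s ^ (-(((n : ℝ) - 1) / (p - 1)))) +
          c * R ^ (-(((n : ℝ) - 1) / (p - 1))) * ε) ^ p)) := by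
  have hn' : (1 : ℝ) ≤ n := by exact_mod_cast hn
  have hγ : 0 ≤ ((n : ℝ) - 1) / (p - 1) := div_nonneg (by linarith) (by linarith)
  set γ := ((n : ℝ) - 1) / (p - 1) with hγdef
  set S := (volume : Measure (EuclideanSpace ℝ (Fin n))).toSphere.real univ
  have hρ0 : 0 < ρ := by linarith
  have hS : 0 ≤ S := measureReal_nonneg
  let h := smoothProfile γ R ε c
  have hh : ContDiff ℝ ∞ h := contDiff_smoothProfile hR hε c
  obtain ⟨hb1, hb2⟩ := smoothProfile_bounds hγ hR hε hc hρ
  have hf : ContDiff ℝ ∞ fun x => h ‖x - x₀‖ :=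
    contDiff_radial hh hR (fun r hr => smoothProfile_of_le hε hr) x₀
  refine (insulationEnergy_le_of_contDiff hβ (Metric.closedBall x₀ R) x₀ hρ0 hf ?_).trans ?_
  · intro x hx
    refine (smoothProfile_of_le hε ?_).ge
    rwa [← dist_eq_norm]
  have hgrad : ∫ x in Metric.ball x₀ ρ, ‖∇ (fun x => h ‖x - x₀‖) x‖ ^ p ≤
      S * (c ^ p * ∫ s in R..ρ, s ^ (-γ)) := by
    have hki := integrableOn_ball_cutoffPower (γ := γ) (c := c) hR hε (by linarith : 0 ≤ p) x₀ ρ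
    have hgi : IntegrableOn (fun x => ‖∇ (fun x => h ‖x - x₀‖) x‖ ^ p) (Metric.ball x₀ ρ) := by
      have : Continuous fun x => ‖∇ (fun x => h ‖x - x₀‖) x‖ ^ p :=
        hf.continuous_gradient'.norm.rpow_const fun _ => Or.inr (by linarith)
      exact memLp_one_iff_integrable.1 (this.memLp_ball 1 x₀ ρ)
    calc ∫ x in Metric.ball x₀ ρ, ‖∇ (fun x => h ‖x - x₀‖) x‖ ^ p
        ≤ ∫ x in Metric.ball x₀ ρ, (c * cutoffPower γ R ε ‖x - x₀‖) ^ p := by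
          refine integral_mono_ae hgi hki ?_
          have : Nonempty (Fin n) := ⟨⟨0, by omega⟩⟩
          filter_upwards [Measure.ae_ne (volume.restrict (Metric.ball x₀ ρ)) x₀] with x hx
          refine Real.rpow_le_rpow (norm_nonneg _) ?_ (by linarith)
          refine (norm_gradient_radial_le (hh.differentiable (by simp)) hx).trans ?_
          rw [(hasDerivAt_smoothProfile hR hε c _).deriv, abs_neg, abs_of_nonneg]
          exact mul_nonneg hc (cutoffPower_nonneg hR hε)
      _ ≤ S * (c ^ p * ∫ s in R..ρ, s ^ (-γ)) :=
          setIntegral_ball_cutoffPower_le hn hp hR hc hε (by linarith) x₀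
  have hbd : ∫ x, |h ‖x - x₀‖| ^ p ∂(boundaryMeasure (Metric.ball x₀ ρ)) =
      S * (ρ ^ (n - 1) * h ρ ^ p) := by
    have : ∫ x, |h ‖x - x₀‖| ^ p ∂(boundaryMeasure (Metric.ball x₀ ρ)) =
        ∫ x, h ρ ^ p ∂(boundaryMeasure (Metric.ball x₀ ρ)) := by
      refine integral_congr_ae ?_
      filter_upwards [ae_boundaryMeasure_ball_mem_sphere x₀ hρ0] with x hx
      rw [mem_sphere_iff_norm] at hx
      rw [hx, abs_of_nonneg (hm.trans hb1)]
    rw [this, integral_const, boundaryMeasure_ball_real_univ x₀ hρ0, smul_eq_mul]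
    ring
  rw [hbd]
  have hpow := Real.rpow_le_rpow (hm.trans hb1) hb2 (by linarith : 0 ≤ p)
  refine (add_le_add hgrad (mul_le_mul_of_nonneg_left (mul_le_mul_of_nonneg_left
    (mul_le_mul_of_nonneg_left hpow (by positivity)) hS) hβ)).trans_eq ?_
  ring

/-- The common denominator of the optimal fluxes. -/
noncomputable def thermalResistance (γ b R ρ : ℝ) : ℝ := (∫ s in R..ρ, s ^ (-γ)) + b * ρ ^ (-γ)

theorem thermalResistance_pos {γ b R ρ : ℝ} (hR : 0 < R) (hρ : R ≤ ρ) (hb : 0 < b) :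
    0 < thermalResistance γ b R ρ :=
  add_pos_of_nonneg_of_pos (intervalIntegral.integral_nonneg hρ fun _ hs =>
    Real.rpow_nonneg (hR.le.trans hs.1) _) (mul_pos hb (Real.rpow_pos_of_pos (hR.trans_le hρ) _))

/-- The constant b = β^(-1/(p-1)) is the one for which |h'|^(p-1) = β h^(p-1) reads h = b |h'|. -/
theorem mul_rpow_eq_of_robin {p β : ℝ} (hp : 1 < p) (hβ : 0 < β) :
    β * (1 / β ^ (1 / (p - 1))) ^ (p - 1) = 1 := by
  have : p - 1 ≠ 0 := by linarith
  rw [Real.div_rpow zero_le_one (by positivity), ← Real.rpow_mul hβ.le, one_div_mul_cancel this]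
  simp [hβ.ne']

/-- The energy of the optimal profile equals its flux. -/
theorem optimal_energy_eq (hn : 1 ≤ n) {p β R ρ c : ℝ} (hp : 1 < p) (hβ : 0 < β) (hρ : 0 < ρ)
    (hc : 0 < c)
    (hcΛ : c * thermalResistance (((n : ℝ) - 1) / (p - 1)) (1 / β ^ (1 / (p - 1))) R ρ = 1) :
    c ^ p * (∫ s in R..ρ, s ^ (-(((n : ℝ) - 1) / (p - 1)))) + β * (ρ ^ (n - 1) *
      (1 / β ^ (1 / (p - 1)) * (c * ρ ^ (-(((n : ℝ) - 1) / (p - 1))))) ^ p) = c ^ (p - 1) := by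
  have hrob := mul_rpow_eq_of_robin hp hβ
  have hb : 0 < 1 / β ^ (1 / (p - 1)) := by positivity
  set b := 1 / β ^ (1 / (p - 1))
  rw [Real.mul_rpow hb.le (by positivity), mul_left_comm (ρ ^ (n - 1)),
    pow_mul_rpow_neg_rpow hn hp hc.le hρ]
  set γ := ((n : ℝ) - 1) / (p - 1)
  have hbp : b ^ p = b ^ (p - 1) * b := by
    rw [← Real.rpow_add_one hb.ne']; ring_nf
  have hcp : c ^ p = c ^ (p - 1) * c := by
    rw [← Real.rpow_add_one hc.ne']; ring_nf
  rw [hbp]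
  calc _ = c ^ p * ((∫ s in R..ρ, s ^ (-γ)) + (β * b ^ (p - 1)) * (b * ρ ^ (-γ))) := by ring
    _ = c ^ p * thermalResistance γ b R ρ := by rw [hrob, one_mul]; rfl
    _ = c ^ (p - 1) * (c * thermalResistance γ b R ρ) := by rw [hcp]; ring
    _ = _ := by rw [hcΛ, mul_one]

theorem insulationEnergy_ball_le (hn : 1 ≤ n) {p β R ρ : ℝ} (hp : 1 < p) (hβ : 0 < β)
    (hR : 0 < R) (hρ : R < ρ) (x₀ : EuclideanSpace ℝ (Fin n)) :
    insulationEnergy β p (Metric.closedBall x₀ R) (Metric.ball x₀ ρ) ≤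
      (volume : Measure (EuclideanSpace ℝ (Fin n))).toSphere.real univ *
      (thermalResistance (((n : ℝ) - 1) / (p - 1)) (1 / β ^ (1 / (p - 1))) R ρ)⁻¹ ^ (p - 1) := by
  set γ := ((n : ℝ) - 1) / (p - 1) with hγdef
  set S := (volume : Measure (EuclideanSpace ℝ (Fin n))).toSphere.real univ
  have hb : 0 < 1 / β ^ (1 / (p - 1)) := by positivity
  set b := 1 / β ^ (1 / (p - 1))
  have hΛ := thermalResistance_pos (γ := γ) hR hρ.le hb
  set Λ := thermalResistance γ b R ρ with hΛdef
  have hρ0 := hR.trans hρ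
  have hc : 0 < Λ⁻¹ := inv_pos.2 hΛ
  set c := Λ⁻¹
  have hcΛ : c * Λ = 1 := inv_mul_cancel₀ hΛ.ne'
  set H := ∫ s in R..ρ, s ^ (-γ)
  -- The choice c = 1/Λ makes the ideal boundary value b times the ideal slope, which is the Robin
  -- condition; in particular this value is positive.
  have hm : 1 - c * H = b * (c * ρ ^ (-γ)) := by
    rw [← hcΛ, hΛdef, thermalResistance]; ring
  have hmp : 0 < b * (c * ρ ^ (-γ)) := by positivity
  have hlim : Tendsto (fun ε => S * (c ^ p * H + β * (ρ ^ (n - 1) *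
      (1 - c * H + c * R ^ (-γ) * ε) ^ p))) (𝓝[>] 0)
      (𝓝 (S * (c ^ p * H + β * (ρ ^ (n - 1) * (1 - c * H + c * R ^ (-γ) * 0) ^ p)))) := by
    refine Tendsto.mono_left (Continuous.tendsto ?_ 0) nhdsWithin_le_nhds
    refine continuous_const.mul (continuous_const.add (continuous_const.mul
      (continuous_const.mul (Continuous.rpow_const (by fun_prop) fun _ => Or.inr (by linarith)))))
  have hval : S * (c ^ p * H + β * (ρ ^ (n - 1) * (1 - c * H + c * R ^ (-γ) * 0) ^ p)) =
      S * c ^ (p - 1) := by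
    rw [mul_zero, add_zero, hm, optimal_energy_eq hn hp hβ hρ0 hc hcΛ]
  rw [← hval]
  refine ge_of_tendsto hlim ?_
  filter_upwards [Ioo_mem_nhdsGT (sub_pos.2 hρ)] with ε hε
  exact insulationEnergy_le_profile hn hp hβ.le hR hc.le hε.1 (by linarith [hε.2]) x₀
    (by rw [hm]; exact hmp.le)

end Upper

/-! ### Passing to the limit in pairings -/

section Limits

/-- `L^p` convergence on a finite measure space implies convergence of integrals against a bounded
field. -/
theorem tendsto_integral_inner_of_tendsto_eLpNorm {X F : Type*} [MeasurableSpace X]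
    [NormedAddCommGroup F] [InnerProductSpace ℝ F] {μ : Measure X} [IsFiniteMeasure μ]
    {q : ENNReal} (hq : 1 ≤ q) {u : X → F} {v : ℕ → X → F} (hu : MemLp u q μ)
    (hv : ∀ k, MemLp (v k) q μ) {W : X → F} (hW : AEStronglyMeasurable W μ) {C : ℝ}
    (hC : ∀ᵐ x ∂μ, ‖W x‖ ≤ C)
    (h : Tendsto (fun k => eLpNorm (fun x => v k x - u x) q μ) atTop (𝓝 0)) :
    Tendsto (fun k => ∫ x, inner ℝ (v k x) (W x) ∂μ) atTop (𝓝 (∫ x, inner ℝ (u x) (W x) ∂μ)) := by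
  have hint : ∀ w : X → F, MemLp w q μ → Integrable (fun x => inner ℝ (w x) (W x)) μ := by
    intro w hw
    have hw1 : Integrable w μ := hw.integrable hq
    refine (hw1.norm.mul_const C).mono' (hw.1.inner hW) ?_
    filter_upwards [hC] with x hx
    exact (norm_inner_le_norm _ _).trans (mul_le_mul_of_nonneg_left hx (norm_nonneg _))
  refine tendsto_integral_of_L1' _ (hint u hu).1 (.of_forall fun k => hint _ (hv k)) ?_
  have hbound : ∀ k, eLpNorm ((fun x => inner ℝ (v k x) (W x)) - fun x => inner ℝ (u x) (W x)) 1 μ ≤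
      C.toNNReal * (eLpNorm (fun x => v k x - u x) q μ *
        μ univ ^ (1 / (1 : ENNReal).toReal - 1 / q.toReal)) := by
    intro k
    have hm : AEStronglyMeasurable (fun x => v k x - u x) μ := (hv k).1.sub hu.1
    refine le_trans ?_ (mul_le_mul' le_rfl (eLpNorm_le_eLpNorm_mul_rpow_measure_univ hq hm))
    refine (eLpNorm_le_nnreal_smul_eLpNorm_of_ae_le_mul (c := C.toNNReal) ?_ 1)
    filter_upwards [hC] with x hx
    rw [← NNReal.coe_le_coe]
    push_cast
    rw [Pi.sub_apply, ← inner_sub_left, Real.coe_toNNReal _ ((norm_nonneg _).trans hx), mul_comm]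
    exact (norm_inner_le_norm _ _).trans (mul_le_mul_of_nonneg_left hx (norm_nonneg _))
  refine tendsto_of_tendsto_of_tendsto_of_le_of_le tendsto_const_nhds ?_ (fun _ => zero_le) hbound
  have hfin : μ univ ^ (1 / (1 : ENNReal).toReal - 1 / q.toReal) ≠ ⊤ := by
    refine ENNReal.rpow_ne_top_of_nonneg ?_ (measure_ne_top _ _)
    rw [ENNReal.toReal_one, div_one, sub_nonneg]
    rcases eq_or_ne q ⊤ with rfl | hq'
    · simp
    · have : 1 ≤ q.toReal := by
        rw [← ENNReal.toReal_one]
        exact (ENNReal.toReal_le_toReal ENNReal.one_ne_top hq').2 hq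
      exact (div_le_one (by linarith)).2 this
  have h1 := ENNReal.Tendsto.mul_const h
    (b := μ univ ^ (1 / (1 : ENNReal).toReal - 1 / q.toReal)) (Or.inr hfin)
  have h2 := ENNReal.Tendsto.const_mul h1 (a := (C.toNNReal : ENNReal))
    (Or.inr ENNReal.coe_ne_top)
  simpa using h2

end Limits

/-! ### Divergence theorem for the cut-off radial field -/

section Flux

variable {n : ℕ}

theorem continuous_div_pow_of_eq_zero {ζ : ℝ → ℝ} (hζ : Continuous ζ) {R₀ : ℝ} (hR : 0 < R₀)
    (h0 : ∀ r ≤ R₀, ζ r = 0) (k : ℕ) : Continuous fun r => ζ r / r ^ k := by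
  rw [continuous_iff_continuousAt]
  intro r
  rcases lt_or_ge r R₀ with hr | hr
  · refine (continuousAt_const (y := (0 : ℝ))).congr ?_
    filter_upwards [Iio_mem_nhds hr] with t ht
    rw [h0 t (le_of_lt ht), zero_div]
  · exact hζ.continuousAt.div (continuousAt_id.pow k) (pow_ne_zero _ (hR.trans_le hr).ne')

theorem deriv_eq_zero_of_eqOn_Iic {ζ : ℝ → ℝ} {R₀ : ℝ} (h0 : ∀ r ≤ R₀, ζ r = 0) {r : ℝ}
    (hr : r < R₀) : deriv ζ r = 0 := by
  have : ζ =ᶠ[𝓝 r] fun _ => 0 := by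
    filter_upwards [Iio_mem_nhds hr] with t ht using h0 t (le_of_lt ht)
  rw [this.deriv_eq, deriv_const]

/-- The divergence theorem on a ball for the field `ζ(|y|) y / |y|ⁿ`, for smooth functions. -/
theorem radial_divergence_smooth (hn : 1 ≤ n) {ζ : ℝ → ℝ} (hζ : ContDiff ℝ ∞ ζ) {R₀ ρ : ℝ}
    (hR₀ : 0 < R₀) (hρ : 0 < ρ) (h0 : ∀ r ≤ 2 * R₀, ζ r = 0) (h1 : ζ ρ = 1)
    (x₀ : EuclideanSpace ℝ (Fin n)) {f : EuclideanSpace ℝ (Fin n) → ℝ} (hf : ContDiff ℝ ∞ f) :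
    (∫ x in Metric.ball x₀ ρ, inner ℝ (∇ f x) ((ζ ‖x - x₀‖ / ‖x - x₀‖ ^ n) • (x - x₀))) +
      (∫ x in Metric.ball x₀ ρ, inner ℝ (f x) (deriv ζ ‖x - x₀‖ / ‖x - x₀‖ ^ (n - 1))) =
    ∫ θ, f (x₀ + ρ • (θ : EuclideanSpace ℝ (Fin n)))
        ∂((volume : Measure (EuclideanSpace ℝ (Fin n))).toSphere) := by
  have hsub : Continuous fun x : EuclideanSpace ℝ (Fin n) => ‖x - x₀‖ :=
    (continuous_id.sub continuous_const).norm
  have hA : Continuous fun x : EuclideanSpace ℝ (Fin n) => ζ ‖x - x₀‖ / ‖x - x₀‖ ^ n :=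
    (continuous_div_pow_of_eq_zero hζ.continuous (by linarith) h0 n).comp hsub
  -- The factor 2 in the vanishing range of ζ leaves room for the derivative to vanish on a closed
  -- half-line with positive endpoint, so that division by a power of r stays continuous.
  have hd0 : ∀ r ≤ R₀, deriv ζ r = 0 := fun r hr => deriv_eq_zero_of_eqOn_Iic h0 (by linarith)
  have hB : Continuous fun x : EuclideanSpace ℝ (Fin n) =>
      deriv ζ ‖x - x₀‖ / ‖x - x₀‖ ^ (n - 1) :=
    (continuous_div_pow_of_eq_zero (hζ.continuous_deriv (by simp)) hR₀ hd0 (n - 1)).comp hsub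
  have hc1 : Continuous fun x => inner ℝ (∇ f x) ((ζ ‖x - x₀‖ / ‖x - x₀‖ ^ n) • (x - x₀)) :=
    hf.continuous_gradient'.inner (hA.smul (continuous_id.sub continuous_const))
  have hc2 : Continuous fun x => inner ℝ (f x) (deriv ζ ‖x - x₀‖ / ‖x - x₀‖ ^ (n - 1)) :=
    hf.continuous.inner hB
  have hi : ∀ {F : EuclideanSpace ℝ (Fin n) → ℝ}, Continuous F →
      IntegrableOn F (Metric.ball x₀ ρ) := fun h =>
    memLp_one_iff_integrable.1 (h.memLp_ball 1 x₀ ρ)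
  rw [← integral_add (hi hc1) (hi hc2),
    setIntegral_ball_eq_integral_sphere hn x₀
      (hi (F := fun x => inner ℝ (∇ f x) ((ζ ‖x - x₀‖ / ‖x - x₀‖ ^ n) • (x - x₀)) +
        inner ℝ (f x) (deriv ζ ‖x - x₀‖ / ‖x - x₀‖ ^ (n - 1))) (hc1.add hc2))]
  refine integral_congr_ae (.of_forall fun θ => ?_)
  have hθ : ‖(θ : EuclideanSpace ℝ (Fin n))‖ = 1 := by simp
  simp only
  have hline : ∀ r : ℝ, HasDerivAt (fun r : ℝ => f (x₀ + r • (θ : EuclideanSpace ℝ (Fin n))))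
      (fderiv ℝ f (x₀ + r • (θ : EuclideanSpace ℝ (Fin n))) θ) r := by
    intro r
    have h2 : HasDerivAt (fun r : ℝ => x₀ + r • (θ : EuclideanSpace ℝ (Fin n))) θ r := by
      simpa using ((hasDerivAt_id r).smul_const (θ : EuclideanSpace ℝ (Fin n))).const_add x₀
    exact (hf.differentiable (by simp) _).hasFDerivAt.comp_hasDerivAt r h2
  have hder : ∀ r : ℝ, HasDerivAt (fun r : ℝ => ζ r * f (x₀ + r • (θ : EuclideanSpace ℝ (Fin n))))
      (deriv ζ r * f (x₀ + r • (θ : EuclideanSpace ℝ (Fin n))) +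
        ζ r * fderiv ℝ f (x₀ + r • (θ : EuclideanSpace ℝ (Fin n))) θ) r := fun r =>
    ((hζ.differentiable (by simp) r).hasDerivAt).mul (hline r)
  have hcl : Continuous fun r : ℝ => x₀ + r • (θ : EuclideanSpace ℝ (Fin n)) :=
    continuous_const.add (continuous_id.smul continuous_const)
  have hcd : Continuous fun r : ℝ => deriv ζ r * f (x₀ + r • (θ : EuclideanSpace ℝ (Fin n))) +
        ζ r * fderiv ℝ f (x₀ + r • (θ : EuclideanSpace ℝ (Fin n))) θ :=
    ((hζ.continuous_deriv (by simp)).mul (hf.continuous.comp hcl)).add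
      (hζ.continuous.mul (((hf.continuous_fderiv (by simp)).comp hcl).clm_apply continuous_const))
  -- After multiplication by r^(n-1), the integrand on each ray is the derivative of ζ(r) f(x₀ +
  -- rθ); the fundamental theorem of calculus leaves only the value at r = ρ.
  calc _ = ∫ r in Ioo (0 : ℝ) ρ, (deriv ζ r * f (x₀ + r • (θ : EuclideanSpace ℝ (Fin n))) +
        ζ r * fderiv ℝ f (x₀ + r • (θ : EuclideanSpace ℝ (Fin n))) θ) := by
        refine setIntegral_congr_fun measurableSet_Ioo fun r hr => ?_
        have hr0 : r ≠ 0 := hr.1.ne'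
        have hnorm : ‖r • (θ : EuclideanSpace ℝ (Fin n))‖ = r := by
          rw [norm_smul, hθ, mul_one, Real.norm_of_nonneg hr.1.le]
        simp only [add_sub_cancel_left, hnorm, inner_smul_right, inner_gradient_left]
        have hpow : r ^ n = r ^ (n - 1) * r := by rw [← pow_succ, Nat.sub_add_cancel hn]
        have hrn : r ^ (n - 1) ≠ 0 := pow_ne_zero _ hr0
        rw [hpow, real_inner_eq_re_inner, RCLike.inner_apply]
        simp only [conj_trivial, RCLike.re_to_real]
        field_simp
        ring
    _ = ζ ρ * f (x₀ + ρ • (θ : EuclideanSpace ℝ (Fin n))) -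
          ζ 0 * f (x₀ + (0 : ℝ) • (θ : EuclideanSpace ℝ (Fin n))) := by
        rw [← integral_Ioc_eq_integral_Ioo, ← intervalIntegral.integral_of_le hρ.le]
        exact intervalIntegral.integral_eq_sub_of_hasDerivAt (fun r _ => hder r)
          (hcd.intervalIntegrable _ _)
    _ = _ := by rw [h1, h0 0 (by linarith)]; ring

/-- The divergence theorem on a ball for the field `ζ(|y|) y / |y|ⁿ`, for Sobolev functions. -/
theorem radial_divergence (hn : 1 ≤ n) {ζ : ℝ → ℝ} (hζ : ContDiff ℝ ∞ ζ) {R₀ ρ p : ℝ} (hp : 1 ≤ p)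
    (hR₀ : 0 < R₀) (hρ : 0 < ρ) (h0 : ∀ r ≤ 2 * R₀, ζ r = 0) (h1 : ζ ρ = 1)
    (x₀ : EuclideanSpace ℝ (Fin n)) {φ g : EuclideanSpace ℝ (Fin n) → ℝ}
    {G : EuclideanSpace ℝ (Fin n) → EuclideanSpace ℝ (Fin n)}
    (hφ : IsSobolevWithGradient p (Metric.ball x₀ ρ) φ G)
    (hg : IsTrace p (Metric.ball x₀ ρ) φ G g) :
    ρ ^ (n - 1) *
      ((∫ x in Metric.ball x₀ ρ, inner ℝ (G x) ((ζ ‖x - x₀‖ / ‖x - x₀‖ ^ n) • (x - x₀))) +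
      (∫ x in Metric.ball x₀ ρ, φ x * (deriv ζ ‖x - x₀‖ / ‖x - x₀‖ ^ (n - 1)))) =
    ∫ x, g x ∂(boundaryMeasure (Metric.ball x₀ ρ)) := by
  have := isFiniteMeasure_restrict_ball x₀ ρ
  have := isFiniteMeasure_boundaryMeasure_ball x₀ hρ
  obtain ⟨hgp, f, hf, hfφ, hfG, hfg⟩ := hg
  have hq : 1 ≤ ENNReal.ofReal p := by rwa [ENNReal.one_le_ofReal]
  have hsub : Continuous fun x : EuclideanSpace ℝ (Fin n) => ‖x - x₀‖ :=
    (continuous_id.sub continuous_const).norm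
  have hA : Continuous fun x : EuclideanSpace ℝ (Fin n) =>
      (ζ ‖x - x₀‖ / ‖x - x₀‖ ^ n) • (x - x₀) :=
    ((continuous_div_pow_of_eq_zero hζ.continuous (by linarith) h0 n).comp hsub).smul
      (continuous_id.sub continuous_const)
  have hd0 : ∀ r ≤ R₀, deriv ζ r = 0 := fun r hr => deriv_eq_zero_of_eqOn_Iic h0 (by linarith)
  have hB : Continuous fun x : EuclideanSpace ℝ (Fin n) =>
      deriv ζ ‖x - x₀‖ / ‖x - x₀‖ ^ (n - 1) :=
    (continuous_div_pow_of_eq_zero (hζ.continuous_deriv (by simp)) hR₀ hd0 (n - 1)).comp hsub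
  obtain ⟨CA, hCA⟩ := (isCompact_closedBall x₀ ρ).exists_bound_of_continuousOn hA.continuousOn
  obtain ⟨CB, hCB⟩ := (isCompact_closedBall x₀ ρ).exists_bound_of_continuousOn hB.continuousOn
  have hae := ae_restrict_ball_mem_closedBall x₀ ρ
  have l1 := tendsto_integral_inner_of_tendsto_eLpNorm hq hφ.memLp_gradient
    (fun k => (hf k).continuous_gradient'.memLp_ball _ x₀ ρ) hA.aestronglyMeasurable
    (hae.mono fun x hx => hCA x hx) hfG
  have l2 := tendsto_integral_inner_of_tendsto_eLpNorm hq hφ.memLp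
    (fun k => (hf k).continuous.memLp_ball _ x₀ ρ) hB.aestronglyMeasurable
    (hae.mono fun x hx => hCB x hx) hfφ
  have l3 := tendsto_integral_inner_of_tendsto_eLpNorm hq hgp
    (fun k => (hf k).continuous.memLp_boundaryMeasure_ball _ x₀ hρ)
    (W := fun _ => (1 : ℝ)) aestronglyMeasurable_const (C := 1) (.of_forall fun x => by simp) hfg
  have hk : ∀ k, ρ ^ (n - 1) * ((∫ x in Metric.ball x₀ ρ,
        inner ℝ (∇ (f k) x) ((ζ ‖x - x₀‖ / ‖x - x₀‖ ^ n) • (x - x₀))) +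
      (∫ x in Metric.ball x₀ ρ, inner ℝ (f k x) (deriv ζ ‖x - x₀‖ / ‖x - x₀‖ ^ (n - 1)))) =
      ∫ x, inner ℝ (f k x) 1 ∂(boundaryMeasure (Metric.ball x₀ ρ)) := by
    intro k
    rw [radial_divergence_smooth hn hζ hR₀ hρ h0 h1 x₀ (hf k),
      ← integral_boundaryMeasure_ball x₀ hρ (hf k).continuous]
    simp
  have l4 := (l1.add l2).const_mul (ρ ^ (n - 1))
  simp only [hk] at l4
  have := tendsto_nhds_unique l4 l3
  simpa [mul_comm] using this

/-- Lower bound for the flux of an admissible function. -/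
theorem flux_integral_le (hn : 1 ≤ n) {ζ : ℝ → ℝ} (hζ : ContDiff ℝ ∞ ζ) {R₀ R ρ p : ℝ} (hp : 1 ≤ p)
    (hR₀ : 0 < R₀) (hR : 0 < R) (hρ : R < ρ) (h0 : ∀ r ≤ 2 * R₀, ζ r = 0) (h1 : ∀ r, R ≤ r → ζ r = 1)
    (hmono : Monotone ζ)
    (x₀ : EuclideanSpace ℝ (Fin n)) {φ g : EuclideanSpace ℝ (Fin n) → ℝ}
    {G : EuclideanSpace ℝ (Fin n) → EuclideanSpace ℝ (Fin n)}
    (hφ : IsSobolevWithGradient p (Metric.ball x₀ ρ) φ G)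
    (hg : IsTrace p (Metric.ball x₀ ρ) φ G g)
    (hφ1 : ∀ᵐ x ∂(volume.restrict (Metric.ball x₀ ρ)), x ∈ Metric.closedBall x₀ R → 1 ≤ φ x) :
    (∫ x in Metric.ball x₀ ρ, inner ℝ (G x) ((ζ ‖x - x₀‖ / ‖x - x₀‖ ^ n) • (x - x₀))) ≤
      (ρ ^ (n - 1))⁻¹ * (∫ x, g x ∂(boundaryMeasure (Metric.ball x₀ ρ))) -
        (volume : Measure (EuclideanSpace ℝ (Fin n))).toSphere.real univ := by
  have := isFiniteMeasure_restrict_ball x₀ ρ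
  have hρ0 := hR.trans hρ
  have hq : 1 ≤ ENNReal.ofReal p := by rwa [ENNReal.one_le_ofReal]
  have hρn : ρ ^ (n - 1) ≠ 0 := pow_ne_zero _ hρ0.ne'
  rw [← radial_divergence hn hζ hp hR₀ hρ0 h0 (h1 ρ hρ.le) x₀ hφ hg, inv_mul_cancel_left₀ hρn]
  -- The constant function 1 in the divergence identity shows that the weight ζ'(|y|)/|y|^(n-1) has
  -- total mass S.
  have hone := radial_divergence_smooth hn hζ hR₀ hρ0 h0 (h1 ρ hρ.le) x₀ (f := fun _ => 1)
    contDiff_const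
  have hgrad : ∀ x : EuclideanSpace ℝ (Fin n),
      ∇ (fun _ : EuclideanSpace ℝ (Fin n) => (1 : ℝ)) x = 0 := fun x => by
    rw [← norm_eq_zero, norm_gradient_eq_norm_fderiv]; simp
  have hd0 : ∀ r ≤ R₀, deriv ζ r = 0 := fun r hr => deriv_eq_zero_of_eqOn_Iic h0 (by linarith)
  have hB : Continuous fun x : EuclideanSpace ℝ (Fin n) =>
      deriv ζ ‖x - x₀‖ / ‖x - x₀‖ ^ (n - 1) :=
    (continuous_div_pow_of_eq_zero (hζ.continuous_deriv (by simp)) hR₀ hd0 (n - 1)).comp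
      (continuous_id.sub continuous_const).norm
  have hS : (volume : Measure (EuclideanSpace ℝ (Fin n))).toSphere.real univ =
      ∫ x in Metric.ball x₀ ρ, deriv ζ ‖x - x₀‖ / ‖x - x₀‖ ^ (n - 1) := by
    simp only [hgrad, inner_zero_left, integral_zero, zero_add, integral_const, smul_eq_mul,
      mul_one] at hone
    rw [← hone]
    simp
  obtain ⟨CB, hCB⟩ := (isCompact_closedBall x₀ ρ).exists_bound_of_continuousOn hB.continuousOn
  -- The weight is nonnegative because ζ is monotone, and it vanishes for |y| > R because ζ is
  -- constant there; so it only sees points with φ ≥ 1.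
  have hle : (volume : Measure (EuclideanSpace ℝ (Fin n))).toSphere.real univ ≤
      ∫ x in Metric.ball x₀ ρ, φ x * (deriv ζ ‖x - x₀‖ / ‖x - x₀‖ ^ (n - 1)) := by
    rw [hS]
    refine integral_mono_ae (memLp_one_iff_integrable.1 (hB.memLp_ball 1 x₀ ρ)) ?_ ?_
    · refine (hφ.memLp.integrable hq).mul_bdd (c := CB) hB.aestronglyMeasurable ?_
      exact (ae_restrict_ball_mem_closedBall x₀ ρ).mono fun x hx => hCB x hx
    · filter_upwards [hφ1] with x hx
      rcases le_or_gt ‖x - x₀‖ R with hxR | hxR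
      · have h3 : 1 ≤ φ x := hx (by rwa [Metric.mem_closedBall, dist_eq_norm])
        exact le_mul_of_one_le_left
          (div_nonneg hmono.deriv_nonneg (pow_nonneg (norm_nonneg _) _)) h3
      · have : ζ =ᶠ[𝓝 ‖x - x₀‖] fun _ => 1 := by
          filter_upwards [Ioi_mem_nhds hxR] with t ht using h1 t (le_of_lt ht)
        rw [this.deriv_eq, deriv_const]
        simp
  linarith

end Flux

/-! ### Lower bound by calibration -/

section Lower

variable {n : ℕ}

/-- The convex function t^p lies above its tangent line at t = s. Equality at t = s keeps the
calibration sharp. -/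
theorem young_rpow {p s t : ℝ} (hp : 1 < p) (hs : 0 ≤ s) (ht : 0 ≤ t) :
    p * (t * s ^ (p - 1)) ≤ t ^ p + (p - 1) * s ^ p := by
  have hpq : p.HolderConjugate (p / (p - 1)) := Real.HolderConjugate.conjExponent hp
  have h := Real.young_inequality_of_nonneg ht (Real.rpow_nonneg hs (p - 1)) hpq
  have hp1 : p - 1 ≠ 0 := by linarith
  rw [← Real.rpow_mul hs, mul_div_cancel₀ _ hp1] at h
  have h2 := mul_le_mul_of_nonneg_left h (by linarith : 0 ≤ p)
  refine h2.trans_eq ?_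
  field_simp

/-- The p-flux density of the optimal profile decays like r^(1-n), which makes the calibrating field
divergence free. -/
theorem rpow_mul_rpow_neg_rpow_sub_one (hn : 1 ≤ n) {p c r : ℝ} (hp : 1 < p) (hc : 0 ≤ c)
    (hr : 0 < r) :
    (c * r ^ (-(((n : ℝ) - 1) / (p - 1)))) ^ (p - 1) = c ^ (p - 1) * (r ^ (n - 1))⁻¹ := by
  have hp1 : p - 1 ≠ 0 := by linarith
  rw [Real.mul_rpow hc (Real.rpow_nonneg hr.le _), ← Real.rpow_mul hr.le, neg_mul,
    div_mul_cancel₀ _ hp1, Real.rpow_neg hr.le, ← Real.rpow_natCast r (n - 1), Nat.cast_sub hn,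
    Nat.cast_one]

/-- Young's inequality integrated over the sphere, with s = m a free constant that later becomes the
boundary value of the optimal profile. -/
theorem boundary_energy_ge {p β ρ m : ℝ} (hp : 1 < p) (hβ : 0 ≤ β) (hρ : 0 < ρ) (hm : 0 ≤ m)
    (x₀ : EuclideanSpace ℝ (Fin n)) {g : EuclideanSpace ℝ (Fin n) → ℝ}
    (hg : MemLp g (ENNReal.ofReal p) (boundaryMeasure (Metric.ball x₀ ρ))) :
    p * (β * m ^ (p - 1)) * (∫ x, g x ∂(boundaryMeasure (Metric.ball x₀ ρ))) -
      (p - 1) * (β * (ρ ^ (n - 1) * m ^ p)) *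
        (volume : Measure (EuclideanSpace ℝ (Fin n))).toSphere.real univ ≤
      β * ∫ x, |g x| ^ p ∂(boundaryMeasure (Metric.ball x₀ ρ)) := by
  have := isFiniteMeasure_boundaryMeasure_ball x₀ hρ
  have hq : 1 ≤ ENNReal.ofReal p := by rw [ENNReal.one_le_ofReal]; exact hp.le
  have hgi : Integrable g (boundaryMeasure (Metric.ball x₀ ρ)) := hg.integrable hq
  have hgp : Integrable (fun x => |g x| ^ p) (boundaryMeasure (Metric.ball x₀ ρ)) := by
    have := hg.integrable_norm_rpow (by simp; linarith) ENNReal.ofReal_ne_top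
    rwa [ENNReal.toReal_ofReal (by linarith)] at this
  have h : ∫ x, (p * m ^ (p - 1) * g x - (p - 1) * m ^ p) ∂(boundaryMeasure (Metric.ball x₀ ρ)) ≤
      ∫ x, |g x| ^ p ∂(boundaryMeasure (Metric.ball x₀ ρ)) := by
    refine integral_mono ((hgi.const_mul _).sub (integrable_const _)) hgp fun x => ?_
    have h1 := young_rpow hp hm (abs_nonneg (g x))
    have h2 : p * m ^ (p - 1) * g x ≤ p * m ^ (p - 1) * |g x| :=
      mul_le_mul_of_nonneg_left (le_abs_self _)
        (mul_nonneg (by linarith) (Real.rpow_nonneg hm _))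
    simp only
    linarith
  rw [integral_sub (hgi.const_mul _) (integrable_const _), integral_const_mul, integral_const,
    boundaryMeasure_ball_real_univ x₀ hρ, smul_eq_mul] at h
  refine le_trans (le_of_eq ?_) (mul_le_mul_of_nonneg_left h hβ)
  ring

/-- Young's inequality is applied pointwise with s = c r^(-γ), cut off near the centre. Its product
term dominates the pairing of G with the calibrating field, which `flux_integral_le` controls. -/
theorem gradient_energy_ge (hn : 1 ≤ n) {p R ρ c ε : ℝ} (hp : 1 < p) (hR : 0 < R)
    (hρ : R < ρ) (hc : 0 ≤ c) (hε : 0 < ε) (hεR : 2 * ε < R)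
    (x₀ : EuclideanSpace ℝ (Fin n)) {φ g : EuclideanSpace ℝ (Fin n) → ℝ}
    {G : EuclideanSpace ℝ (Fin n) → EuclideanSpace ℝ (Fin n)}
    (hφ : IsSobolevWithGradient p (Metric.ball x₀ ρ) φ G)
    (hg : IsTrace p (Metric.ball x₀ ρ) φ G g)
    (hφ1 : ∀ᵐ x ∂(volume.restrict (Metric.ball x₀ ρ)), x ∈ Metric.closedBall x₀ R → 1 ≤ φ x) :
    p * c ^ (p - 1) * ((volume : Measure (EuclideanSpace ℝ (Fin n))).toSphere.real univ -
        (ρ ^ (n - 1))⁻¹ * ∫ x, g x ∂(boundaryMeasure (Metric.ball x₀ ρ))) -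
      (p - 1) * ((volume : Measure (EuclideanSpace ℝ (Fin n))).toSphere.real univ *
        (c ^ p * ∫ s in (R - 2 * ε)..ρ, s ^ (-(((n : ℝ) - 1) / (p - 1))))) ≤
      ∫ x in Metric.ball x₀ ρ, ‖G x‖ ^ p := by
  have := isFiniteMeasure_restrict_ball x₀ ρ
  have hq : 1 ≤ ENNReal.ofReal p := by rw [ENNReal.one_le_ofReal]; exact hp.le
  have hcut := setIntegral_ball_cutoffPower_le hn hp (R := R - 2 * ε) (ρ := ρ) (by linarith)
    hc hε (by linarith) x₀
  have hrel := fun r : ℝ => rpow_mul_rpow_neg_rpow_sub_one (r := r) hn hp hc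
  set γ := ((n : ℝ) - 1) / (p - 1)
  have hcuti := integrableOn_ball_cutoffPower (γ := γ) (c := c) (by linarith : 0 < R - 2 * ε) hε
    (by linarith : 0 ≤ p) x₀ ρ
  -- ζ rises from 0 to 1 on [R - ε, R], inside the region where φ ≥ 1.
  let ζ : ℝ → ℝ := fun r => Real.smoothTransition ((r - (R - ε)) / ε)
  have hζ : ContDiff ℝ ∞ ζ := Real.smoothTransition.contDiff.comp
    ((contDiff_id.sub contDiff_const).div_const _)
  have h0 : ∀ r ≤ R - ε, ζ r = 0 := fun r hr =>
    Real.smoothTransition.zero_of_nonpos (div_nonpos_of_nonpos_of_nonneg (by linarith) hε.le)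
  have h1 : ∀ r, R ≤ r → ζ r = 1 := fun r hr =>
    Real.smoothTransition.one_of_one_le (by rw [le_div_iff₀ hε]; linarith)
  have hmono : Monotone ζ := fun r s hrs => Real.smoothTransition.monotone (by gcongr)
  have hflux := flux_integral_le hn hζ hp.le (R₀ := (R - ε) / 2) (by linarith) hR hρ
    (fun r hr => h0 r (by linarith)) h1 hmono x₀ hφ hg hφ1
  set W : EuclideanSpace ℝ (Fin n) → EuclideanSpace ℝ (Fin n) :=
    fun x => (ζ ‖x - x₀‖ / ‖x - x₀‖ ^ n) • (x - x₀)
  have hW : Continuous W :=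
    ((continuous_div_pow_of_eq_zero hζ.continuous (by linarith : 0 < R - ε) h0 n).comp
      (continuous_id.sub continuous_const).norm).smul (continuous_id.sub continuous_const)
  have hGi : IntegrableOn (fun x => ‖G x‖ ^ p) (Metric.ball x₀ ρ) := by
    have := hφ.memLp_gradient.integrable_norm_rpow (by simp; linarith) ENNReal.ofReal_ne_top
    rwa [ENNReal.toReal_ofReal (by linarith)] at this
  have hGW : IntegrableOn (fun x => inner ℝ (G x) (W x)) (Metric.ball x₀ ρ) := by
    obtain ⟨C, hC⟩ := (isCompact_closedBall x₀ ρ).exists_bound_of_continuousOn hW.continuousOn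
    refine ((hφ.memLp_gradient.integrable hq).norm.mul_const C).mono'
      (hφ.memLp_gradient.1.inner hW.aestronglyMeasurable) ?_
    filter_upwards [ae_restrict_ball_mem_closedBall x₀ ρ] with x hx
    exact (norm_inner_le_norm _ _).trans (mul_le_mul_of_nonneg_left (hC x hx) (norm_nonneg _))
  -- The field W vanishes for |x - x₀| ≤ R - ε. Starting the cutoff of the power at R - 2ε makes it
  -- the full power beyond R - ε, so it dominates W everywhere.
  have hWle : ∀ x, c ^ (p - 1) * ‖W x‖ ≤
      (c * cutoffPower γ (R - 2 * ε) ε ‖x - x₀‖) ^ (p - 1) := by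
    intro x
    have hnn : 0 ≤ (c * cutoffPower γ (R - 2 * ε) ε ‖x - x₀‖) ^ (p - 1) :=
      Real.rpow_nonneg (mul_nonneg hc (cutoffPower_nonneg (by linarith) hε)) _
    rcases le_or_gt ‖x - x₀‖ (R - ε) with hx | hx
    · have : W x = 0 := by simp only [W]; rw [h0 _ hx, zero_div, zero_smul]
      rw [this, norm_zero, mul_zero]
      exact hnn
    · have hx0 : 0 < ‖x - x₀‖ := by linarith
      rw [cutoffPower_of_ge hε (by linarith), hrel _ hx0]
      refine mul_le_mul_of_nonneg_left ?_ (Real.rpow_nonneg hc _)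
      have hpow : ‖x - x₀‖ ^ n = ‖x - x₀‖ ^ (n - 1) * ‖x - x₀‖ := by
        rw [← pow_succ, Nat.sub_add_cancel hn]
      have hζ0 : 0 ≤ ζ ‖x - x₀‖ := Real.smoothTransition.nonneg _
      have hζ1 : ζ ‖x - x₀‖ ≤ 1 := Real.smoothTransition.le_one _
      simp only [W]
      rw [norm_smul, Real.norm_of_nonneg (by positivity), hpow]
      calc ζ ‖x - x₀‖ / (‖x - x₀‖ ^ (n - 1) * ‖x - x₀‖) * ‖x - x₀‖
          = ζ ‖x - x₀‖ * (‖x - x₀‖ ^ (n - 1))⁻¹ := by field_simp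
        _ ≤ 1 * (‖x - x₀‖ ^ (n - 1))⁻¹ := by gcongr
        _ = _ := one_mul _
  have hint : ∫ x in Metric.ball x₀ ρ, (-(p * c ^ (p - 1)) * inner ℝ (G x) (W x) -
      (p - 1) * (c * cutoffPower γ (R - 2 * ε) ε ‖x - x₀‖) ^ p) ≤
      ∫ x in Metric.ball x₀ ρ, ‖G x‖ ^ p := by
    refine integral_mono ((hGW.const_mul _).sub (hcuti.const_mul _)) hGi fun x => ?_
    have hy := young_rpow hp (mul_nonneg hc (cutoffPower_nonneg (γ := γ) (s := ‖x - x₀‖)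
      (by linarith : 0 < R - 2 * ε) hε)) (norm_nonneg (G x))
    have h3 : -inner ℝ (G x) (W x) ≤ ‖G x‖ * ‖W x‖ :=
      (neg_le_abs _).trans (abs_real_inner_le_norm _ _)
    have h4 : c ^ (p - 1) * -inner ℝ (G x) (W x) ≤
        ‖G x‖ * (c * cutoffPower γ (R - 2 * ε) ε ‖x - x₀‖) ^ (p - 1) :=
      calc _ ≤ c ^ (p - 1) * (‖G x‖ * ‖W x‖) :=
            mul_le_mul_of_nonneg_left h3 (Real.rpow_nonneg hc _)
        _ = ‖G x‖ * (c ^ (p - 1) * ‖W x‖) := by ring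
        _ ≤ _ := mul_le_mul_of_nonneg_left (hWle x) (norm_nonneg _)
    have h5 := mul_le_mul_of_nonneg_left h4 (by linarith : 0 ≤ p)
    simp only
    linarith
  rw [integral_sub (hGW.const_mul _) (hcuti.const_mul _), integral_const_mul,
    integral_const_mul] at hint
  have h6 := mul_le_mul_of_nonneg_left hflux
    (mul_nonneg (by linarith : 0 ≤ p) (Real.rpow_nonneg hc (p - 1)))
  have h7 := mul_le_mul_of_nonneg_left hcut (by linarith : 0 ≤ p - 1)
  linarith

theorem admissible_energy_ge (hn : 1 ≤ n) {p β R ρ : ℝ} (hp : 1 < p) (hβ : 0 < β)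
    (hR : 0 < R) (hρ : R < ρ) (x₀ : EuclideanSpace ℝ (Fin n))
    {φ g : EuclideanSpace ℝ (Fin n) → ℝ}
    {G : EuclideanSpace ℝ (Fin n) → EuclideanSpace ℝ (Fin n)}
    (hφ : IsSobolevWithGradient p (Metric.ball x₀ ρ) φ G)
    (hg : IsTrace p (Metric.ball x₀ ρ) φ G g)
    (hφ1 : ∀ᵐ x ∂(volume.restrict (Metric.ball x₀ ρ)), x ∈ Metric.closedBall x₀ R → 1 ≤ φ x) :
    (volume : Measure (EuclideanSpace ℝ (Fin n))).toSphere.real univ *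
      (thermalResistance (((n : ℝ) - 1) / (p - 1)) (1 / β ^ (1 / (p - 1))) R ρ)⁻¹ ^ (p - 1) ≤
      (∫ x in Metric.ball x₀ ρ, ‖G x‖ ^ p) +
        β * ∫ x, |g x| ^ p ∂(boundaryMeasure (Metric.ball x₀ ρ)) := by
  have hn' : (1 : ℝ) ≤ n := by exact_mod_cast hn
  have hγ : 0 ≤ ((n : ℝ) - 1) / (p - 1) := div_nonneg (by linarith) (by linarith)
  have hb : 0 < 1 / β ^ (1 / (p - 1)) := by positivity
  have hρ0 := hR.trans hρ
  have hΛ := thermalResistance_pos (γ := ((n : ℝ) - 1) / (p - 1)) hR hρ.le hb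
  have hopt := optimal_energy_eq hn hp hβ hρ0 (inv_pos.2 hΛ) (inv_mul_cancel₀ hΛ.ne')
  have hrob := mul_rpow_eq_of_robin hp hβ
  set b := 1 / β ^ (1 / (p - 1))
  set c := (thermalResistance (((n : ℝ) - 1) / (p - 1)) b R ρ)⁻¹
  have hc : 0 < c := inv_pos.2 hΛ
  have hrel := rpow_mul_rpow_neg_rpow_sub_one hn hp hc.le hρ0
  have hgrad := fun ε => gradient_energy_ge hn (ε := ε) hp hR hρ hc.le (x₀ := x₀) (hφ := hφ)
    (hg := hg) (hφ1 := hφ1)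
  set γ := ((n : ℝ) - 1) / (p - 1)
  set S := (volume : Measure (EuclideanSpace ℝ (Fin n))).toSphere.real univ
  have hS : 0 ≤ S := measureReal_nonneg
  set E := (∫ x in Metric.ball x₀ ρ, ‖G x‖ ^ p) +
        β * ∫ x, |g x| ^ p ∂(boundaryMeasure (Metric.ball x₀ ρ)) with hE
  have hm : 0 < b * (c * ρ ^ (-γ)) := by positivity
  have hbd := boundary_energy_ge hp hβ.le hρ0 hm.le x₀ hg.1
  -- The Robin condition gives the trace integral the same coefficient in the boundary and gradient
  -- estimates, so it drops out of their sum.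
  have hflux : β * (b * (c * ρ ^ (-γ))) ^ (p - 1) = c ^ (p - 1) * (ρ ^ (n - 1))⁻¹ := by
    rw [Real.mul_rpow hb.le (by positivity), ← mul_assoc, hrob, one_mul, hrel]
  rw [hflux] at hbd
  -- What remains is p S c^(p-1) minus (p - 1) times the optimal energy S c^(p-1), up to the error
  -- from the layer [R - 2ε, R], which vanishes with ε.
  have key : ∀ ε, 0 < ε → 2 * ε < R →
      S * c ^ (p - 1) - (p - 1) * (S * (c ^ p * (2 * ε * (R - 2 * ε) ^ (-γ)))) ≤ E := by
    intro ε hε hεR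
    have h1 := hgrad ε hε hεR
    have h2 := intervalIntegral.integral_add_adjacent_intervals
      (intervalIntegrable_rpow_neg (γ := γ) (by linarith : 0 < R - 2 * ε) hR)
      (intervalIntegrable_rpow_neg (γ := γ) hR hρ0)
    have h3 := integral_rpow_neg_le hγ (by linarith : 0 < R - 2 * ε)
      (by linarith : R - 2 * ε ≤ R)
    rw [sub_sub_cancel] at h3
    rw [← h2] at h1
    have h4 : (p - 1) * (S * (c ^ p * ∫ s in (R - 2 * ε)..R, s ^ (-γ))) ≤
        (p - 1) * (S * (c ^ p * (2 * ε * (R - 2 * ε) ^ (-γ)))) := by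
      have : 0 ≤ p - 1 := by linarith
      have : 0 ≤ c ^ p := Real.rpow_nonneg hc.le _
      gcongr
    have h5 : (p - 1) * S * (c ^ p * (∫ s in R..ρ, s ^ (-γ)) +
        β * (ρ ^ (n - 1) * (b * (c * ρ ^ (-γ))) ^ p)) = (p - 1) * S * c ^ (p - 1) := by
      rw [hopt]
    rw [hE]
    linarith
  have hlim : Tendsto (fun ε => S * c ^ (p - 1) -
      (p - 1) * (S * (c ^ p * (2 * ε * (R - 2 * ε) ^ (-γ))))) (𝓝[>] 0) (𝓝 (S * c ^ (p - 1))) := by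
    have hcont : ContinuousAt (fun ε : ℝ => S * c ^ (p - 1) -
        (p - 1) * (S * (c ^ p * (2 * ε * (R - 2 * ε) ^ (-γ))))) 0 := by
      have : ContinuousAt (fun ε : ℝ => (R - 2 * ε) ^ (-γ)) 0 :=
        ContinuousAt.rpow_const (by fun_prop) (Or.inl (by simpa using hR.ne'))
      fun_prop
    have := hcont.tendsto
    simp only [mul_zero, zero_mul, sub_zero] at this
    exact this.mono_left nhdsWithin_le_nhds
  refine le_of_tendsto hlim ?_
  filter_upwards [Ioo_mem_nhdsGT (half_pos hR)] with ε hε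
  exact key ε hε.1 (by linarith [hε.2])

/-- The insulation energy of a ball inside a concentric ball. -/
theorem insulationEnergy_ball (hn : 1 ≤ n) {p β R ρ : ℝ} (hp : 1 < p) (hβ : 0 < β)
    (hR : 0 < R) (hρ : R < ρ) (x₀ : EuclideanSpace ℝ (Fin n)) :
    insulationEnergy β p (Metric.closedBall x₀ R) (Metric.ball x₀ ρ) =
      (volume : Measure (EuclideanSpace ℝ (Fin n))).toSphere.real univ *
      (thermalResistance (((n : ℝ) - 1) / (p - 1)) (1 / β ^ (1 / (p - 1))) R ρ)⁻¹ ^ (p - 1) := by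
  refine le_antisymm (insulationEnergy_ball_le hn hp hβ hR hρ x₀) ?_
  refine le_csInf ?_ ?_
  -- The constant 1 is admissible, so the infimum is over a nonempty set.
  · have hf : ContDiff ℝ ∞ fun _ : EuclideanSpace ℝ (Fin n) => (1 : ℝ) := contDiff_const
    exact ⟨_, _, _, _, isSobolevWithGradient_of_contDiff hf p x₀ ρ,
      isTrace_of_contDiff hf p x₀ (hR.trans hρ), .of_forall fun _ _ => le_rfl, rfl⟩
  · rintro E ⟨φ, G, g, hφ, hg, hφ1, rfl⟩
    exact admissible_energy_ge hn hp hβ hR hρ x₀ hφ hg hφ1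

theorem insulationEnergyThickness_closedBall (hn : 1 ≤ n) {p β R δ : ℝ} (hp : 1 < p) (hβ : 0 < β)
    (hR : 0 < R) (hδ : 0 < δ) (x₀ : EuclideanSpace ℝ (Fin n)) :
    insulationEnergyThickness β p δ (Metric.closedBall x₀ R) =
      (volume : Measure (EuclideanSpace ℝ (Fin n))).toSphere.real univ *
      (thermalResistance (((n : ℝ) - 1) / (p - 1)) (1 / β ^ (1 / (p - 1))) R (R + δ))⁻¹ ^
        (p - 1) := by
  rw [insulationEnergyThickness, smul_unitBall_of_pos hδ, closedBall_add_ball hR.le hδ, add_zero]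
  exact insulationEnergy_ball hn hp hβ hR (by linarith) x₀

end Lower

/-! ### Critical radius and monotonicity -/

section Monotonicity

/-- The factor 1 - γb/ρ weighs the added insulation against the larger exposed surface; its sign
changes at the critical radius ρ = γb. -/
theorem hasDerivAt_thermalResistance {γ b R ρ : ℝ} (hR : 0 < R) (hρ : 0 < ρ) :
    HasDerivAt (thermalResistance γ b R) (ρ ^ (-γ) * (1 - γ * b / ρ)) ρ := by
  have h1 := intervalIntegral.integral_hasDerivAt_right
    (intervalIntegrable_rpow_neg (γ := γ) hR hρ)
    (ContinuousOn.stronglyMeasurableAtFilter isOpen_Ioi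
      (fun s hs => (Real.continuousAt_rpow_const s (-γ) (Or.inl (ne_of_gt hs))).continuousWithinAt)
      ρ hρ) (Real.continuousAt_rpow_const ρ (-γ) (Or.inl hρ.ne'))
  have h2 := (Real.hasDerivAt_rpow_const (p := -γ) (Or.inl hρ.ne')).const_mul b
  convert! h1.add h2 using 1
  rw [Real.rpow_sub_one hρ.ne']
  ring

theorem strictMonoOn_thermalResistance {γ b R a : ℝ} (hR : 0 < R) (ha : 0 < a) (hab : γ * b ≤ a) :
    StrictMonoOn (thermalResistance γ b R) (Ici a) := by
  refine strictMonoOn_of_deriv_pos (convex_Ici a) (fun ρ hρ =>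
    (hasDerivAt_thermalResistance hR (ha.trans_le hρ)).continuousAt.continuousWithinAt) ?_
  intro ρ hρ
  rw [interior_Ici] at hρ
  have hρ0 : 0 < ρ := ha.trans hρ
  rw [(hasDerivAt_thermalResistance hR hρ0).deriv]
  refine mul_pos (Real.rpow_pos_of_pos hρ0 _) (sub_pos.2 ((div_lt_one hρ0).2 ?_))
  exact hab.trans_lt hρ

theorem strictAntiOn_thermalResistance {γ b R : ℝ} (hR : 0 < R) :
    StrictAntiOn (thermalResistance γ b R) (Icc R (γ * b)) := by
  refine strictAntiOn_of_deriv_neg (convex_Icc R (γ * b)) (fun ρ hρ =>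
    (hasDerivAt_thermalResistance hR (hR.trans_le hρ.1)).continuousAt.continuousWithinAt) ?_
  intro ρ hρ
  rw [interior_Icc] at hρ
  have hρ0 : 0 < ρ := hR.trans hρ.1
  rw [(hasDerivAt_thermalResistance hR hρ0).deriv]
  exact mul_neg_of_pos_of_neg (Real.rpow_pos_of_pos hρ0 _)
    (sub_neg.2 ((one_lt_div hρ0).2 hρ.2))

theorem mul_inv_rpow_lt {S p x y : ℝ} (hS : 0 < S) (hp : 1 < p) (hx : 0 < x) (hxy : x < y) :
    S * y⁻¹ ^ (p - 1) < S * x⁻¹ ^ (p - 1) := by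
  have hy : 0 < y := hx.trans hxy
  refine mul_lt_mul_of_pos_left ?_ hS
  exact Real.rpow_lt_rpow (inv_nonneg.2 hy.le) (inv_strictAnti₀ hx hxy) (by linarith)

/-- The threshold condition on `β` in terms of the critical radius. -/
theorem rpow_le_iff_critical_radius_le {a p β R : ℝ} (ha : 0 ≤ a) (hp : 1 < p) (hβ : 0 < β)
    (hR : 0 < R) :
    (a / (R * (p - 1))) ^ (p - 1) ≤ β ↔ a / (p - 1) * (1 / β ^ (1 / (p - 1))) ≤ R := by
  have hp1 : 0 < p - 1 := by linarith
  have hβ' : 0 < β ^ (1 / (p - 1)) := by positivity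
  have h1 : β = (β ^ (1 / (p - 1))) ^ (p - 1) := by
    rw [← Real.rpow_mul hβ.le, one_div_mul_cancel hp1.ne', Real.rpow_one]
  nth_rw 1 [h1]
  rw [Real.rpow_le_rpow_iff (by positivity) hβ'.le hp1, div_le_iff₀ (by positivity), mul_one_div,
    div_le_iff₀ hβ', div_le_iff₀ hp1]
  ring_nf

end Monotonicity

theorem mainTheorem3 (n : ℕ) (hn : 1 ≤ n) (p β R : ℝ) (hp : 1 < p) (hβ : 0 < β) (hR : 0 < R)
    (x₀ : EuclideanSpace ℝ (Fin n)) :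
    ((((n : ℝ) - 1) / (R * (p - 1))) ^ (p - 1) ≤ β →
      StrictAntiOn (fun δ : ℝ => insulationEnergyThickness β p δ (Metric.closedBall x₀ R))
        (Ioi 0)) ∧
    (β < (((n : ℝ) - 1) / (R * (p - 1))) ^ (p - 1) →
      StrictMonoOn (fun δ : ℝ => insulationEnergyThickness β p δ (Metric.closedBall x₀ R))
        (Ioo 0 (((n : ℝ) - 1) / (p - 1) * (1 / β ^ (1 / (p - 1))) - R)) ∧
      StrictAntiOn (fun δ : ℝ => insulationEnergyThickness β p δ (Metric.closedBall x₀ R))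
        (Ioi (((n : ℝ) - 1) / (p - 1) * (1 / β ^ (1 / (p - 1))) - R))) := by
  have ha : 0 ≤ (n : ℝ) - 1 := by
    have : (1 : ℝ) ≤ n := by exact_mod_cast hn
    linarith
  have hb : 0 < 1 / β ^ (1 / (p - 1)) := by positivity
  have hform := fun δ hδ => insulationEnergyThickness_closedBall (δ := δ) hn hp hβ hR hδ x₀
  have hiff := rpow_le_iff_critical_radius_le ha hp hβ hR
  have hS := toSphere_real_univ_pos hn
  set γ := ((n : ℝ) - 1) / (p - 1)
  set b := 1 / β ^ (1 / (p - 1))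
  -- Used with d₀ = 0 when γb ≤ R, and with d₀ = γb - R otherwise.
  have hanti : ∀ d₀, 0 ≤ d₀ → γ * b ≤ R + d₀ →
      StrictAntiOn (fun δ : ℝ => insulationEnergyThickness β p δ (Metric.closedBall x₀ R))
        (Ioi d₀) := by
    intro d₀ hd₀ hle δ₁ (h₁ : d₀ < δ₁) δ₂ (h₂ : d₀ < δ₂) h
    simp only
    rw [hform δ₁ (by linarith), hform δ₂ (by linarith)]
    refine mul_inv_rpow_lt hS hp (thermalResistance_pos hR (by linarith) hb) ?_
    exact strictMonoOn_thermalResistance hR (by linarith) hle (mem_Ici.2 (by linarith))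
      (mem_Ici.2 (by linarith)) (by linarith)
  refine ⟨fun h => hanti 0 le_rfl (by rw [add_zero]; exact hiff.1 h), fun h => ⟨?_, ?_⟩⟩
  · intro δ₁ h₁ δ₂ h₂ h12
    simp only
    rw [hform δ₁ h₁.1, hform δ₂ h₂.1]
    refine mul_inv_rpow_lt hS hp (thermalResistance_pos hR (by linarith [h₂.1]) hb) ?_
    exact strictAntiOn_thermalResistance hR ⟨by linarith [h₁.1], by linarith [h₁.2]⟩
      ⟨by linarith [h₂.1], by linarith [h₂.2]⟩ (by linarith)
  · have : R < γ * b := not_le.1 fun hcon => not_le.2 h (hiff.2 hcon)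
    exact hanti _ (by linarith) (by linarith)
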